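/- Let $\mathbb K$ be a field and let $s\ge 1$. Conventions. A connected graded algebra is a unital associative $\mathbb K$-algebra $\mathcal A=\bigoplus_{n\ge 0}\mathcal A_n$ graded as an algebra with $\mathcal A_0=\mathbb K\,1$; $\varepsilon:\mathcal A\to\mathbb K$ is the projection on degree $0$, and it makes $\mathbb K$ the trivial (left or right) $\mathcal A$-module. The global dimension of $\mathcal A$ is the supremum of the projective dimensions of all left $\mathcal A$-modules. An algebra $\mathcal A$ of global dimension $D$ is Gorenstein if $\mathrm{Ext}^n_{\mathcal A}(\mathbb K,\mathcal A)=0$ for $n\neq D$ and $\mathrm{Ext}^D_{\mathcal A}(\mathbb K,\mathcal A)$ is isomorphic to the trivial right $\mathcal A$-module $\mathbb K$ (the right action comes from right multiplication on $\mathcal A$). A quadratic algebra $\mathcal A=T(E)/(R)$, with $E$ finite-dimensional, $R\subset E\otimes E$ and dual quadratic algebra $\mathcal A^!=T(E^*)/(R^\perp)$, is Koszul if its Koszul complex of left modules $\cdots\to\mathcal A\otimes(\mathcal A^!_{n+1})^*\to\mathcal A\otimes(\mathcal A^!_n)^*\to\cdots\to\mathcal A\to 0$ is acyclic in positive degrees;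 here the differential is induced by $a\otimes(v_1\otimes\cdots\otimes v_{n+1})\mapsto av_1\otimes(v_2\otimes\cdots\otimes v_{n+1})$ via $(\mathcal A^!_n)^*\subset E^{\otimes n}$. (1) Let $b$ be a nondegenerate bilinear form on $\mathbb K^{s+1}$ with components $B_{\mu\nu}=b(e_\mu,e_\nu)$ in the canonical basis. Then the quadratic algebra $\mathcal A(b)$ generated by $x^0,\dots,x^s$ with the single relation $\sum_{\mu,\nu}B_{\mu\nu}x^\mu x^\nu=0$ is Koszul, of global dimension $2$, and Gorenstein. (2) Conversely, let $\mathcal A$ be a connected graded algebra generated by $s+1$ elements $x^0,\dots,x^s$ of degree $1$ with homogeneous relations of degrees $\ge 2$, which is of global dimension $2$ and Gorenstein. Then there is a nondegenerate bilinear form $b$ on $\mathbb K^{s+1}$ and an isomorphism of graded algebras $\mathcal A(b)\cong\mathcal A$ that maps the generators $x^\lambda$ of $\mathcal A(b)$ to the $x^\lambda\in\mathcal A$. -/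

import Mathlib

open CategoryTheory
open scoped TensorProduct DirectSum

universe u

/-! ## Connected graded algebras -/

section Graded

variable {K A : Type u} [Field K] [Ring A] [Algebra K A]

/-- An `ℕ`-graded `K`-algebra is connected if its degree `0` component is `K` (times the unit). -/
class IsConnectedGraded (𝒜 : ℕ → Submodule K A) [GradedAlgebra 𝒜] : Prop where
  bijective : Function.Bijective (algebraMap K (𝒜 0))

variable (𝒜 : ℕ → Submodule K A) [GradedAlgebra 𝒜] [IsConnectedGraded 𝒜]

/-- The projection `ε : A → K` of a connected graded algebra on its degree `0` component. -/
noncomputable def augmentation : A →+* K :=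
  ((RingEquiv.ofBijective (algebraMap K (𝒜 0)) IsConnectedGraded.bijective).symm :
    𝒜 0 →+* K).comp (GradedRing.projZeroRingHom' 𝒜)

/-- The trivial left module `K` of a connected graded algebra `A`: the element `a` acts on `K` as
multiplication by `ε a`. -/
noncomputable def trivialModule : ModuleCat.{u} A :=
  (ModuleCat.restrictScalars (augmentation 𝒜)).obj (ModuleCat.of K K)

end Graded

/-! ## Global dimension and the Gorenstein property -/

/-- The (left) global dimension of a ring: the supremum of the projective dimensions of all left
modules. -/
noncomputable def globalDimension (A : Type u) [Ring A] : WithBot ℕ∞ :=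
  ⨆ M : ModuleCat.{u} A, projectiveDimension M

/-- Right multiplication by `a`, as an endomorphism of the left module `A`. -/
noncomputable def rightMul {A : Type u} [Ring A] (a : A) :
    ModuleCat.of A A ⟶ ModuleCat.of A A :=
  ModuleCat.ofHom (LinearMap.toSpanSingleton A A a)

/-- The right action of `A` on `Ext_A^n(M, A)`, by functoriality in the second variable. -/
noncomputable def extRightAction {A : Type u} [Ring A] {M : ModuleCat.{u} A} {n : ℕ}
    (α : Abelian.Ext M (ModuleCat.of A A) n) (a : A) :
    Abelian.Ext M (ModuleCat.of A A) n :=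
  α.comp (Abelian.Ext.mk₀ (rightMul a)) (add_zero n)

/-- The Gorenstein property, in dimension `D`, of a connected graded algebra `A`:
`Ext_A^n(K, A) = 0` for `n ≠ D`, while `Ext_A^D(K, A)` is the trivial right `A`-module `K`. -/
def IsGorenstein {K A : Type u} [Field K] [Ring A] [Algebra K A]
    (𝒜 : ℕ → Submodule K A) [GradedAlgebra 𝒜] [IsConnectedGraded 𝒜] (D : ℕ) : Prop :=
  (∀ n : ℕ, n ≠ D →
    Subsingleton (Abelian.Ext (trivialModule 𝒜) (ModuleCat.of A A) n)) ∧
  ∃ e : Abelian.Ext (trivialModule 𝒜) (ModuleCat.of A A) D ≃+ K,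
    ∀ (α : Abelian.Ext (trivialModule 𝒜) (ModuleCat.of A A) D) (a : A),
      e (extRightAction α a) = e α * augmentation 𝒜 a

/-! ## Generators of degree `1` and relations of degree at least `2` -/

/-- The elements of degree `n` of the free algebra, its generators being of degree `1`. -/
def freeGrading (K : Type u) [Field K] (ι : Type) (n : ℕ) : Submodule K (FreeAlgebra K ι) :=
  Submodule.span K (Set.range (FreeAlgebra.ι K)) ^ n

/-- The graded algebra `A` is generated by the elements `x i` of degree `1`, with a set `S` of
homogeneous relations of degrees `≥ 2`. -/
structure IsGeneratedInDegreeOne {K A : Type u} [Field K] [Ring A] [Algebra K A]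
    (𝒜 : ℕ → Submodule K A) {ι : Type} (x : ι → A) : Prop where
  degree_one : ∀ i, x i ∈ 𝒜 1
  generates : Algebra.adjoin K (Set.range x) = ⊤
  relations : ∃ S : Set (FreeAlgebra K ι),
    (∀ r ∈ S, ∃ n : ℕ, 2 ≤ n ∧ r ∈ freeGrading K ι n) ∧
    ∀ f : FreeAlgebra K ι, FreeAlgebra.lift K x f = 0 ↔ f ∈ TwoSidedIdeal.span S

/-! ## Quadratic algebras -/

section Quadratic

variable {K : Type u} [Field K] {ι : Type} [Fintype ι]

/-- The quadratic element `B_{μν} x^μ x^ν` of the free algebra. -/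
noncomputable def quadraticElement (B : Matrix ι ι K) : FreeAlgebra K ι :=
  ∑ μ, ∑ ν, B μ ν • (FreeAlgebra.ι K μ * FreeAlgebra.ι K ν)

/-- The relations `B_{μν} x^μ x^ν = 0`, for `B ∈ R`. -/
def quadraticRel (R : Submodule K (Matrix ι ι K)) : FreeAlgebra K ι → FreeAlgebra K ι → Prop :=
  fun a c => ∃ B ∈ R, a = quadraticElement B ∧ c = 0

/-- The quadratic algebra `A(E, R) = T(E) / (R)`, for `E` with the basis `x^μ` (`μ ∈ ι`) and a
subspace `R` of `E ⊗ E`, the matrix `B` standing for the tensor `B_{μν} x^μ ⊗ x^ν`. -/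
abbrev QuadraticAlg (R : Submodule K (Matrix ι ι K)) : Type u :=
  RingQuot (quadraticRel R)

namespace QuadraticAlg

variable (R : Submodule K (Matrix ι ι K))

/-- The generator `x^μ`. -/
noncomputable def gen (μ : ι) : QuadraticAlg R :=
  RingQuot.mkAlgHom K (quadraticRel R) (FreeAlgebra.ι K μ)

/-- The elements of degree `n` of the quadratic algebra. -/
noncomputable def grading (n : ℕ) : Submodule K (QuadraticAlg R) :=
  Submodule.span K (Set.range (gen R)) ^ n

theorem gen_mem (μ : ι) : gen R μ ∈ grading R 1 := by
  rw [grading, pow_one]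
  exact Submodule.subset_span ⟨μ, rfl⟩

instance : SetLike.GradedMonoid (grading R) where
  one_mem := by rw [grading, pow_zero]; exact Submodule.one_le.mp le_rfl
  mul_mem i j a c ha hc := by
    rw [grading, pow_add]; exact Submodule.mul_mem_mul ha hc

theorem sum_gen_mul_gen {B : Matrix ι ι K} (hB : B ∈ R) :
    ∑ μ, ∑ ν, B μ ν • (gen R μ * gen R ν) = 0 := by
  have h := RingQuot.mkAlgHom_rel K (s := quadraticRel R) ⟨B, hB, rfl, rfl⟩
  simpa [quadraticElement, gen] using h

/-- A linear combination of products of two generators that satisfy the relations defines an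
algebra homomorphism. -/
noncomputable def lift {C : Type*} [Semiring C] [Algebra K C] (y : ι → C)
    (hy : ∀ B ∈ R, ∑ μ, ∑ ν, B μ ν • (y μ * y ν) = 0) : QuadraticAlg R →ₐ[K] C :=
  RingQuot.liftAlgHom K ⟨FreeAlgebra.lift K y, by
    rintro _ _ ⟨B, hB, rfl, rfl⟩
    simpa [quadraticElement] using hy B hB⟩

theorem lift_gen {C : Type*} [Semiring C] [Algebra K C] (y : ι → C)
    (hy : ∀ B ∈ R, ∑ μ, ∑ ν, B μ ν • (y μ * y ν) = 0) (μ : ι) :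
    lift R y hy (gen R μ) = y μ := by
  simp [lift, gen]

theorem hom_ext {C : Type*} [Semiring C] [Algebra K C] {f g : QuadraticAlg R →ₐ[K] C}
    (h : ∀ μ, f (gen R μ) = g (gen R μ)) : f = g := by
  apply RingQuot.ringQuot_ext'
  ext μ
  exact h μ

/-- The generator `x^μ` as an element of degree `1` of the direct sum of the components. -/
noncomputable def gradedGen (μ : ι) : ⨁ n, grading R n :=
  DirectSum.of (fun n => grading R n) 1 ⟨gen R μ, gen_mem R μ⟩

theorem gradedGen_rel {B : Matrix ι ι K} (hB : B ∈ R) :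
    ∑ μ, ∑ ν, B μ ν • (gradedGen R μ * gradedGen R ν) = 0 := by
  have key : ∀ μ ν, B μ ν • (gradedGen R μ * gradedGen R ν) =
      DirectSum.lof K ℕ (fun n => grading R n) (1 + 1)
        (B μ ν • ⟨gen R μ * gen R ν, SetLike.mul_mem_graded (gen_mem R μ) (gen_mem R ν)⟩) := by
    intro μ ν
    rw [map_smul, gradedGen, gradedGen, DirectSum.of_mul_of]
    rfl
  simp_rw [key, ← map_sum]
  have h0 : ∑ μ, ∑ ν, B μ ν • (⟨gen R μ * gen R ν,
      SetLike.mul_mem_graded (gen_mem R μ) (gen_mem R ν)⟩ : grading R (1 + 1)) = 0 := by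
    apply Subtype.ext
    simpa using sum_gen_mul_gen R hB
  rw [h0, map_zero]

/-- The homomorphism to the direct sum of the components that maps `x^μ` to `x^μ`. -/
noncomputable def gradedLift : QuadraticAlg R →ₐ[K] ⨁ n, grading R n :=
  lift R (gradedGen R) fun _ hB => gradedGen_rel R hB

theorem gradedLift_span (m : QuadraticAlg R) (hm : m ∈ Submodule.span K (Set.range (gen R))) :
    gradedLift R m = DirectSum.of (fun n => grading R n) 1 ⟨m, by rwa [grading, pow_one]⟩ := by
  induction hm using Submodule.span_induction with
  | mem m hm => obtain ⟨μ, rfl⟩ := hm; rw [gradedLift, lift_gen]; rfl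
  | zero => rw [map_zero]; exact (map_zero _).symm
  | add a c ha hc iha ihc => rw [map_add, iha, ihc, ← map_add]; rfl
  | smul r a ha iha =>
    rw [map_smul, iha]
    exact (map_smul (DirectSum.lof K ℕ (fun n => grading R n) 1) r _).symm

theorem gradedLift_mem (i : ℕ) (a : QuadraticAlg R) (ha : a ∈ grading R i) :
    gradedLift R a = DirectSum.of (fun n => grading R n) i ⟨a, ha⟩ := by
  have ha' : a ∈ Submodule.span K (Set.range (gen R)) ^ i := ha
  induction ha' using Submodule.pow_induction_on_left' with
  | algebraMap r => rw [AlgHom.commutes, DirectSum.algebraMap_apply]; rfl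
  | add a c i hp hq iha ihc => rw [map_add, iha hp, ihc hq, ← map_add]; rfl
  | mem_mul m hm i a hp ih =>
    rw [map_mul, ih hp, gradedLift_span R m hm, DirectSum.of_mul_of]
    exact DirectSum.of_eq_of_gradedMonoid_eq (Sigma.subtype_ext (add_comm _ _) rfl)

noncomputable instance gradedAlgebra : GradedAlgebra (grading R) :=
  GradedAlgebra.ofAlgHom (grading R) (gradedLift R)
    (by
      apply hom_ext
      intro μ
      rw [AlgHom.comp_apply, gradedLift, lift_gen, gradedGen, DirectSum.coeAlgHom_of]
      rfl)
    fun i a => gradedLift_mem R i a a.2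

instance : IsConnectedGraded (grading R) where
  bijective := by
    constructor
    · intro r t h
      have h0 : algebraMap K (QuadraticAlg R) r = algebraMap K (QuadraticAlg R) t :=
        congrArg Subtype.val h
      have h1 := congrArg (lift R (fun _ => (0 : K)) (by simp)) h0
      simpa using h1
    · rintro ⟨a, ha⟩
      have ha' := ha
      rw [grading, pow_zero] at ha'
      obtain ⟨r, rfl⟩ := Submodule.mem_one.mp ha'
      exact ⟨r, rfl⟩

/-- The orthogonal `R^⊥ ⊆ E^* ⊗ E^*` of `R ⊆ E ⊗ E`, with `E^*` given the dual basis `e_μ`. -/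
def orthogonal : Submodule K (Matrix ι ι K) where
  carrier := {C | ∀ B ∈ R, ∑ μ, ∑ ν, B μ ν * C μ ν = 0}
  zero_mem' := by simp
  add_mem' {C C'} h h' B hB := by
    simp [mul_add, Finset.sum_add_distrib, h B hB, h' B hB]
  smul_mem' r C h B hB := by
    simp_rw [Matrix.smul_apply, smul_eq_mul, mul_left_comm _ r, ← Finset.mul_sum]
    rw [h B hB, mul_zero]

/-- The dual quadratic algebra `A^! = A(E^*, R^⊥)`, with generators `e_μ`. -/
abbrev Dual : Type u := QuadraticAlg (orthogonal R)

/-- The elements of degree `n` of the dual quadratic algebra. -/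
abbrev DualComponent (n : ℕ) : Type u := grading (orthogonal R) n

/-- Left multiplication by `e_μ`, from degree `n` to degree `n + 1` of the dual algebra. -/
noncomputable def dualLeftMul (μ : ι) (n : ℕ) : DualComponent R n →ₗ[K] DualComponent R (n + 1) :=
  (LinearMap.mulLeft K (gen (orthogonal R) μ)).restrict fun a ha => by
    rw [grading, pow_succ']
    exact Submodule.mul_mem_mul (Submodule.subset_span ⟨μ, rfl⟩) ha

/-- The left module `A ⊗ (A^!_n)^*` of degree `n` of the Koszul complex. -/
abbrev KoszulModule (n : ℕ) : Type u := QuadraticAlg R ⊗[K] Module.Dual K (DualComponent R n)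

/-- The differential `A ⊗ (A^!_{n+1})^* → A ⊗ (A^!_n)^*` of the Koszul complex. With `(A^!_n)^*`
seen in `E^{⊗ n}` by `φ ↦ φ(e_{μ₁} ⋯ e_{μ_n}) x^{μ₁} ⊗ ⋯ ⊗ x^{μ_n}`, it is induced by
`a ⊗ (v₁ ⊗ ⋯ ⊗ v_{n+1}) ↦ a v₁ ⊗ (v₂ ⊗ ⋯ ⊗ v_{n+1})`, so it maps `a ⊗ φ` to
`a x^μ ⊗ φ(e_μ ·)` (summed over `μ`). -/
noncomputable def koszulDifferential (n : ℕ) :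
    KoszulModule R (n + 1) →ₗ[QuadraticAlg R] KoszulModule R n :=
  ∑ μ, TensorProduct.AlgebraTensorModule.map
    (LinearMap.toSpanSingleton (QuadraticAlg R) (QuadraticAlg R) (gen R μ))
    (dualLeftMul R μ n).dualMap

/-- The quadratic algebra `A(E, R)` is Koszul if its Koszul complex is acyclic in positive
degrees. -/
def IsKoszul : Prop :=
  ∀ n : ℕ, Function.Exact (koszulDifferential R (n + 1)) (koszulDifferential R n)

end QuadraticAlg

/-- The relation space of the quadratic algebra associated with a bilinear form `b` on `K^{s+1}`:
the line spanned by the tensor with the components `B_{μν} = b(e_μ, e_ν)`. -/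
noncomputable def formRelations {s : ℕ} (b : LinearMap.BilinForm K (Fin (s + 1) → K)) :
    Submodule K (Matrix (Fin (s + 1)) (Fin (s + 1)) K) :=
  Submodule.span K {Matrix.of fun μ ν => b (Pi.single μ 1) (Pi.single ν 1)}

end Quadratic

/-! Write `v_ν = ∑_μ B_{μν} x^μ`, so that the relation reads `∑_ν v_ν x^ν = 0`. Everything turns on
the complex `0 → A → A^{s+1} → A → K → 0` of left modules with maps `a ↦ (a v_ν)` and `(a_ν) ↦ ∑ a_ν
x^ν`.

Direct part. Exactness in the middle comes from derivations: an algebra with one relation admits a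
derivation with prescribed values on the generators as soon as these values respect the relation.
Taking values in `A^{s+1}/Av`, the derivation sends `∑ a_ν x^ν` to the class of `a`
(`exists_eq_mul_leftCoeff`). Injectivity on the left says that nonzero linear forms are regular, by
induction on the degree (`eq_zero_of_mul_linearCombination_eq_zero`). Applying `Hom(-, A)` gives the
mirror complex `b ↦ (x^ν b)`, `(c_ν) ↦ ∑ v_ν c_ν`; reversing products leads back to the transposed
matrix, and the cokernel is `A/A_+ = K` because `B` is invertible. This is the Gorenstein property.
The same derivation argument with values in `Hom_K(M, Q)` resolves every module `M` by `A ⊗ M`, `(A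
⊗ M)^{s+1}`, `A ⊗ M`, which bounds the global dimension by `2`. Finally `A^!_2` is a line and `A^!_n
= 0` for `n ≥ 3`, so the Koszul complex is the complex above without its term `K`.

Converse. Let `S ⊂ A^{s+1}` be the module of relations `∑ a_ν x^ν = 0`. Dimension `2` makes `S`
projective, and `Ext²(K, A)` is `Hom(S, A)` modulo restrictions of forms on `A^{s+1}`. Entries of
`S` lie in `A_+`, so `Ext²(K, A) ≅ K` forces `S/A_+S` to be a line, and Nakayama gives `S = Av` with
`v` homogeneous (`exists_generator_syzygies`). Triviality of the right action yields `u x^l ∈ ∑ v_ν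
A` with `ε(u) ≠ 0`; in degree `1` this forces the `v_ν` to be linear forms spanning `A_1`, that is,
`B` is invertible. Since `S = Av`, an induction on the degree shows that `A` has no further
relations (`injective_of_exact`). -/

/-! ### Ext groups from a spliced pair of short exact sequences -/

section ExtOfResolution

open Abelian

universe w v

variable {C : Type u} [Category.{v} C] [Abelian C] [HasExt.{w} C]
  {Z P₁ Ω P₀ M : C} {j : Z ⟶ P₁} {q : P₁ ⟶ Ω} {i : Ω ⟶ P₀} {p : P₀ ⟶ M}
  {wjq : j ≫ q = 0} {wip : i ≫ p = 0}

/-- The map `Hom(Z, N) → Ext²(M, N)` given by the Yoneda product with the class of an extension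
`0 → Z → P₁ → P₀ → M → 0`, spliced from two short exact sequences. -/
noncomputable def spliceExt (hq : (ShortComplex.mk j q wjq).ShortExact)
    (hp : (ShortComplex.mk i p wip).ShortExact) (N : C) : (Z ⟶ N) →+ Ext M N 2 where
  toFun f := hp.extClass.comp (hq.extClass.comp (Ext.mk₀ f) (add_zero 1)) one_add_one_eq_two
  map_zero' := by simp
  map_add' f g := by rw [Ext.mk₀_add, Ext.comp_add, Ext.comp_add]

theorem spliceExt_comp (hq : (ShortComplex.mk j q wjq).ShortExact)
    (hp : (ShortComplex.mk i p wip).ShortExact) {N N' : C} (f : Z ⟶ N) (g : N ⟶ N') :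
    (spliceExt hq hp N f).comp (Ext.mk₀ g) (add_zero 2) = spliceExt hq hp N' (f ≫ g) := by
  simp [spliceExt, ← Ext.mk₀_comp_mk₀]

/-- Dimension shifting: `Ext²(P₀, N)` and `Ext¹(P₁, N)` vanish, so both connecting maps are onto. -/
theorem spliceExt_surjective (hq : (ShortComplex.mk j q wjq).ShortExact)
    (hp : (ShortComplex.mk i p wip).ShortExact) [Projective P₁] [Projective P₀] (N : C) :
    Function.Surjective (spliceExt hq hp N) := by
  intro α
  obtain ⟨β, rfl⟩ := Ext.contravariant_sequence_exact₃ hp N α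
    (Ext.eq_zero_of_projective _) one_add_one_eq_two
  obtain ⟨γ, rfl⟩ := Ext.contravariant_sequence_exact₃ hq N β
    (Ext.eq_zero_of_projective _) (add_zero 1)
  obtain ⟨f, rfl⟩ := (Ext.mk₀_bijective _ _).2 γ
  exact ⟨f, rfl⟩

/-- The outer connecting map is injective because `Ext¹(P₀, N) = 0`; the inner one kills exactly the
maps that extend over `P₁`. -/
theorem spliceExt_eq_zero_iff (hq : (ShortComplex.mk j q wjq).ShortExact)
    (hp : (ShortComplex.mk i p wip).ShortExact) [Projective P₀] {N : C} (f : Z ⟶ N) :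
    spliceExt hq hp N f = 0 ↔ ∃ g : P₁ ⟶ N, j ≫ g = f := by
  constructor
  · intro h
    obtain ⟨γ, hγ⟩ := Ext.contravariant_sequence_exact₁ hp N
      (hq.extClass.comp (Ext.mk₀ f) (add_zero 1)) one_add_one_eq_two h
    rw [Ext.eq_zero_of_projective γ, Ext.comp_zero] at hγ
    obtain ⟨δ, hδ⟩ := Ext.contravariant_sequence_exact₁ hq N (Ext.mk₀ f) (add_zero 1) hγ.symm
    obtain ⟨g, rfl⟩ := (Ext.mk₀_bijective _ _).2 δ
    exact ⟨g, (Ext.mk₀_bijective _ _).1 (by simpa using hδ)⟩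
  · rintro ⟨g, rfl⟩
    have h := hq.extClass_comp
    dsimp at h
    have : hq.extClass.comp (Ext.mk₀ (j ≫ g)) (add_zero 1) = 0 := by
      rw [← Ext.mk₀_comp_mk₀, ← Ext.comp_assoc_of_second_deg_zero]
      erw [h]
      simp
    change hp.extClass.comp (hq.extClass.comp (Ext.mk₀ (j ≫ g)) (add_zero 1))
      one_add_one_eq_two = 0
    rw [this, Ext.comp_zero]

/-- A class comes from a map `Ω ⟶ N`; its composite with `q` is a cocycle, so the map extends over
`P₀` and its connecting image is zero. -/
theorem subsingleton_ext_one (hq : (ShortComplex.mk j q wjq).ShortExact)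
    (hp : (ShortComplex.mk i p wip).ShortExact) [Projective P₀] {N : C}
    (h : ∀ g : P₁ ⟶ N, j ≫ g = 0 → ∃ k : P₀ ⟶ N, q ≫ i ≫ k = g) :
    Subsingleton (Ext M N 1) := by
  refine subsingleton_of_forall_eq 0 fun α => ?_
  obtain ⟨β, rfl⟩ := Ext.contravariant_sequence_exact₃ hp N α
    (Ext.eq_zero_of_projective _) (add_zero 1)
  obtain ⟨f, rfl⟩ := (Ext.mk₀_bijective _ _).2 β
  obtain ⟨k, hk⟩ := h (q ≫ f) (by rw [reassoc_of% wjq, Limits.zero_comp])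
  have : Epi q := hq.epi_g
  rw [cancel_epi] at hk
  subst hk
  have h := hp.extClass_comp
  dsimp at h
  rw [← Ext.mk₀_comp_mk₀, ← Ext.comp_assoc_of_second_deg_zero]
  erw [h]
  simp

omit [HasExt.{w} C] in
theorem projective_of_hasProjectiveDimensionLE_two (hq : (ShortComplex.mk j q wjq).ShortExact)
    (hp : (ShortComplex.mk i p wip).ShortExact) [Projective P₁] [Projective P₀]
    [HasProjectiveDimensionLE M 2] : Projective Z := by
  rw [projective_iff_hasProjectiveDimensionLT_one]
  have h : HasProjectiveDimensionLT Ω 2 :=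
    (hp.hasProjectiveDimensionLT_X₃_iff 1 ‹_›).1 ‹_›
  exact (hq.hasProjectiveDimensionLT_X₃_iff 0 ‹_›).1 h

omit [HasExt.{w} C] in
theorem hasProjectiveDimensionLE_two (hq : (ShortComplex.mk j q wjq).ShortExact)
    (hp : (ShortComplex.mk i p wip).ShortExact) [Projective P₁] [Projective P₀]
    [Projective Z] : HasProjectiveDimensionLE M 2 := by
  have h : HasProjectiveDimensionLT Ω 2 :=
    (hq.hasProjectiveDimensionLT_X₃_iff 0 ‹_›).2
      (projective_iff_hasProjectiveDimensionLT_one.1 ‹_›)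
  exact (hp.hasProjectiveDimensionLT_X₃_iff 1 ‹_›).2 h

end ExtOfResolution

/-! ### Cutting an exact sequence of modules at the image of `f₁` -/

section ModuleResolution

open Abelian

variable {A : Type u} [Ring A] {Z P₁ P₀ M : Type u} [AddCommGroup Z] [Module A Z]
  [AddCommGroup P₁] [Module A P₁] [AddCommGroup P₀] [Module A P₀] [AddCommGroup M] [Module A M]
  {f₂ : Z →ₗ[A] P₁} {f₁ : P₁ →ₗ[A] P₀} {f₀ : P₀ →ₗ[A] M}

theorem shortExact_of_injective_of_exact (h₂ : Function.Injective f₂)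
    (h₁ : Function.Exact f₂ f₁) :
    (ShortComplex.mk (ModuleCat.ofHom f₂) (ModuleCat.ofHom f₁.rangeRestrict) (ModuleCat.hom_ext <|
      LinearMap.ext fun z => Subtype.ext (h₁.apply_apply_eq_zero z))).ShortExact where
  exact := by
    rw [ShortComplex.ShortExact.moduleCat_exact_iff_function_exact]
    intro y
    exact (Subtype.ext_iff (a2 := (0 : LinearMap.range f₁))).trans (h₁ y)
  mono_f := (ModuleCat.mono_iff_injective _).2 h₂
  epi_g := (ModuleCat.epi_iff_surjective _).2 f₁.surjective_rangeRestrict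

theorem shortExact_of_exact_of_surjective (h₀ : Function.Exact f₁ f₀)
    (h : Function.Surjective f₀) :
    (ShortComplex.mk (ModuleCat.ofHom (LinearMap.range f₁).subtype) (ModuleCat.ofHom f₀)
      (ModuleCat.hom_ext <| LinearMap.ext fun z => (h₀ z).2 z.2)).ShortExact where
  exact := by
    rw [ShortComplex.ShortExact.moduleCat_exact_iff_function_exact]
    intro y
    refine (h₀ y).trans ?_
    change y ∈ LinearMap.range f₁ ↔ y ∈ Set.range Subtype.val
    simp
  mono_f := (ModuleCat.mono_iff_injective _).2 Subtype.val_injective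
  epi_g := (ModuleCat.epi_iff_surjective _).2 h

end ModuleResolution

/-! ### The augmentation ideal and a Gorenstein criterion -/

section ConnectedGraded

variable {K A : Type u} [Field K] [Ring A] [Algebra K A]
  (𝒜 : ℕ → Submodule K A) [GradedAlgebra 𝒜] [IsConnectedGraded 𝒜]

theorem algebraMap_augmentation (a : A) :
    algebraMap K A (augmentation 𝒜 a) = GradedRing.projZeroRingHom' 𝒜 a := by
  have h := (RingEquiv.ofBijective (algebraMap K (𝒜 0))
    IsConnectedGraded.bijective).apply_symm_apply (GradedRing.projZeroRingHom' 𝒜 a)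
  exact congrArg Subtype.val h

theorem algebraMap_augmentation_eq_decompose (a : A) :
    algebraMap K A (augmentation 𝒜 a) = DirectSum.decompose 𝒜 a 0 :=
  algebraMap_augmentation 𝒜 a

include 𝒜 in
theorem algebraMap_injective_of_isConnectedGraded : Function.Injective (algebraMap K A) :=
  fun _ _ h => (IsConnectedGraded.bijective (𝒜 := 𝒜)).1 (Subtype.ext h)

theorem augmentation_of_mem {n : ℕ} (hn : n ≠ 0) {a : A} (ha : a ∈ 𝒜 n) :
    augmentation 𝒜 a = 0 := by
  apply algebraMap_injective_of_isConnectedGraded 𝒜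
  rw [algebraMap_augmentation_eq_decompose, DirectSum.decompose_of_mem_ne 𝒜 ha hn, map_zero]

theorem augmentation_algebraMap (r : K) : augmentation 𝒜 (algebraMap K A r) = r := by
  apply algebraMap_injective_of_isConnectedGraded 𝒜
  rw [algebraMap_augmentation_eq_decompose,
    DirectSum.decompose_of_mem_same 𝒜 (SetLike.algebraMap_mem_graded 𝒜 r)]

theorem eq_algebraMap_of_mem_zero {a : A} (ha : a ∈ 𝒜 0) :
    a = algebraMap K A (augmentation 𝒜 a) := by
  rw [algebraMap_augmentation_eq_decompose, DirectSum.decompose_of_mem_same 𝒜 ha]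

/-- The projection on the degree `0` component, as a homomorphism of left modules. -/
noncomputable def augmentationHom : A →ₗ[A] trivialModule 𝒜 where
  toFun a := augmentation 𝒜 a
  map_add' := map_add _
  map_smul' a c := map_mul (augmentation 𝒜) a c

theorem augmentationHom_surjective : Function.Surjective (augmentationHom 𝒜) := fun r =>
  ⟨algebraMap K A r, augmentation_algebraMap 𝒜 r⟩

variable {ι : Type} [Fintype ι] {x : ι → A}

/-- An algebra that is generated by finitely many elements is the sum of the scalars and of the
left ideal generated by these elements. -/
theorem exists_eq_algebraMap_add_sum {K A : Type*} [Field K] [Ring A] [Algebra K A]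
    {ι : Type*} [Fintype ι] {x : ι → A} (hx : Algebra.adjoin K (Set.range x) = ⊤) (a : A) :
    ∃ (r : K) (c : ι → A), a = algebraMap K A r + ∑ μ, c μ * x μ := by
  classical
  have ha : a ∈ Algebra.adjoin K (Set.range x) := hx ▸ Algebra.mem_top
  induction ha using Algebra.adjoin_induction with
  | mem a ha =>
    obtain ⟨μ, rfl⟩ := ha
    exact ⟨0, Pi.single μ 1, by simp [Pi.single_apply]⟩
  | algebraMap r => exact ⟨r, 0, by simp⟩
  | add a b _ _ iha ihb =>
    obtain ⟨r, c, rfl⟩ := iha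
    obtain ⟨t, d, rfl⟩ := ihb
    exact ⟨r + t, c + d, by simp [add_mul, Finset.sum_add_distrib]; abel⟩
  | mul a b _ _ iha ihb =>
    obtain ⟨r, c, hc⟩ := iha
    obtain ⟨t, d, rfl⟩ := ihb
    -- Expand `a * (t + ∑ d x)`: the term `a * t` contributes `r * t + ∑ t c x`, the others already
    -- end in a generator.
    refine ⟨r * t, fun μ => t • c μ + a * d μ, ?_⟩
    simp only [add_mul, Finset.sum_add_distrib, mul_add, mul_assoc, Finset.mul_sum, map_mul]
    rw [← add_assoc]
    congr 1
    rw [← Algebra.commutes, hc, mul_add, Finset.mul_sum, ← Algebra.commutes r]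
    simp [Algebra.smul_def, mul_assoc]

theorem exists_eq_sum_of_augmentation_eq_zero (hx1 : ∀ μ, x μ ∈ 𝒜 1)
    (hx : Algebra.adjoin K (Set.range x) = ⊤) {a : A} (ha : augmentation 𝒜 a = 0) :
    ∃ c : ι → A, a = ∑ μ, c μ * x μ := by
  obtain ⟨r, c, rfl⟩ := exists_eq_algebraMap_add_sum hx a
  refine ⟨c, ?_⟩
  have h : augmentation 𝒜 (∑ μ, c μ * x μ) = 0 := by
    simp [augmentation_of_mem 𝒜 one_ne_zero (hx1 _)]
  rw [map_add, h, augmentation_algebraMap, add_zero] at ha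
  rw [ha, map_zero, zero_add]

theorem exact_linearCombination_augmentationHom (hx1 : ∀ μ, x μ ∈ 𝒜 1)
    (hx : Algebra.adjoin K (Set.range x) = ⊤) :
    Function.Exact (Fintype.linearCombination A x) (augmentationHom 𝒜) := by
  intro a
  constructor
  · intro ha
    obtain ⟨c, rfl⟩ := exists_eq_sum_of_augmentation_eq_zero 𝒜 hx1 hx ha
    exact ⟨c, by simp [Fintype.linearCombination_apply]⟩
  · rintro ⟨c, rfl⟩
    change augmentation 𝒜 _ = 0
    simp [Fintype.linearCombination_apply, augmentation_of_mem 𝒜 one_ne_zero (hx1 _)]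

/-- The component of degree `n + m` of a product whose second factor is homogeneous. -/
theorem decompose_mul_of_mem {σ : Type*} {A : Type*} [Ring A] [SetLike σ A]
    [AddSubgroupClass σ A] (𝒜 : ℕ → σ) [GradedRing 𝒜] {m : ℕ} {v : A} (hv : v ∈ 𝒜 m) (a : A)
    (n : ℕ) : (DirectSum.decompose 𝒜 (a * v) (n + m) : A) = DirectSum.decompose 𝒜 a n * v :=
  DirectSum.coe_decompose_mul_add_of_right_mem 𝒜 hv

open Abelian

/-- A criterion for the Gorenstein property in dimension `2`, in terms of the generators `x μ` and
of the coefficients `v ν` of a relation `∑ ν, v ν * x ν = 0`. -/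
theorem isGorenstein_two_of_exact (hx1 : ∀ μ, x μ ∈ 𝒜 1)
    (hx : Algebra.adjoin K (Set.range x) = ⊤) (v : ι → A)
    (hinj : ∀ a, (∀ ν, a * v ν = 0) → a = 0)
    (hv : ∑ ν, v ν * x ν = 0)
    (hexact : ∀ a : ι → A, ∑ ν, a ν * x ν = 0 → ∃ d, ∀ ν, a ν = d * v ν)
    (hinj' : ∀ a, (∀ ν, x ν * a = 0) → a = 0)
    (hexact' : ∀ a : ι → A, ∑ ν, v ν * a ν = 0 → ∃ d, ∀ ν, a ν = x ν * d)
    (haug : ∀ a, augmentation 𝒜 a = 0 ↔ ∃ c : ι → A, a = ∑ ν, v ν * c ν) :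
    IsGorenstein 𝒜 2 := by
  classical
  have h₂ : Function.Injective (LinearMap.toSpanSingleton A (ι → A) v) := by
    rw [injective_iff_map_eq_zero]
    intro a ha
    exact hinj a fun ν => congrFun ha ν
  have h₁ : Function.Exact (LinearMap.toSpanSingleton A (ι → A) v)
      (Fintype.linearCombination A x) := by
    intro a
    simp only [Fintype.linearCombination_apply, smul_eq_mul]
    constructor
    · intro ha
      obtain ⟨d, hd⟩ := hexact a ha
      exact ⟨d, funext fun ν => (hd ν).symm⟩
    · rintro ⟨d, rfl⟩
      simp [mul_assoc, ← Finset.mul_sum, hv]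
  have hq := shortExact_of_injective_of_exact h₂ h₁
  have hp := shortExact_of_exact_of_surjective
    (exact_linearCombination_augmentationHom 𝒜 hx1 hx) (augmentationHom_surjective 𝒜)
  have hpi (g : (ι → A) →ₗ[A] A) (a : ι → A) : g a = ∑ ν, a ν * g (Pi.single ν 1) := by
    conv_lhs => rw [pi_eq_sum_univ' a]
    simp [map_sum]
  have P₁ : Projective (ModuleCat.of A (ι → A)) := ModuleCat.projective_of_free (Pi.basisFun A ι)
  have P₀ : Projective (ModuleCat.of A A) :=
    ModuleCat.projective_of_free (Module.Basis.singleton Unit A)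
  have hM := hasProjectiveDimensionLE_two hq hp
  -- A form `f` on the last term extends along `a ↦ (a v_ν)` exactly when `f 1 ∈ ∑ v_ν A`, and
  -- `haug` identifies this right ideal with `A_+`.
  have hsub (f : A →ₗ[A] A) :
      spliceExt hq hp _ (ModuleCat.ofHom f) = 0 ↔ augmentation 𝒜 (f 1) = 0 := by
    rw [spliceExt_eq_zero_iff, haug]
    constructor
    · rintro ⟨g, hg⟩
      refine ⟨fun ν => g.hom (Pi.single ν 1), ?_⟩
      rw [← hpi, show f = g.hom ∘ₗ LinearMap.toSpanSingleton A (ι → A) v from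
        (congrArg ModuleCat.Hom.hom hg).symm]
      simp
    · rintro ⟨c, hc⟩
      refine ⟨ModuleCat.ofHom (Fintype.linearCombination A c), ?_⟩
      ext
      simp [Fintype.linearCombination_apply, hc]
  refine ⟨fun n hn => ?_, ?_⟩
  · obtain rfl | rfl | hn : n = 0 ∨ n = 1 ∨ 3 ≤ n := by omega
    · refine Ext.addEquiv₀.toEquiv.subsingleton_congr.2 (subsingleton_of_forall_eq 0 fun g => ?_)
      ext t
      obtain ⟨r, rfl⟩ := augmentationHom_surjective 𝒜 t
      rw [← mul_one r, ← smul_eq_mul, map_smul]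
      -- The generators act by zero on the trivial module, so the image of `1` is killed by them on
      -- the left.
      have : g.hom (augmentationHom 𝒜 1) = 0 := by
        refine hinj' _ fun ν => ?_
        rw [← smul_eq_mul, ← map_smul, ← map_smul]
        rw [show augmentationHom 𝒜 (x ν • 1) = 0 from ?_, map_zero]
        change augmentation 𝒜 (x ν * 1) = 0
        rw [mul_one, augmentation_of_mem 𝒜 one_ne_zero (hx1 ν)]
      rw [map_smul, this, smul_zero]
      rfl
    · refine subsingleton_ext_one hq hp fun g hg => ?_
      have hg' : ∑ ν, v ν * g.hom (Pi.single ν 1) = 0 := by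
        rw [← hpi]
        have := LinearMap.congr_fun (congrArg ModuleCat.Hom.hom hg) 1
        simpa using this
      obtain ⟨d, hd⟩ := hexact' _ hg'
      refine ⟨ModuleCat.ofHom (LinearMap.toSpanSingleton A A d), ?_⟩
      refine ModuleCat.hom_ext (LinearMap.ext fun a => ?_)
      change (Fintype.linearCombination A x a) * d = g.hom a
      rw [hpi g.hom a, Fintype.linearCombination_apply, Finset.sum_mul]
      simp [hd, mul_assoc]
    · exact HasProjectiveDimensionLT.subsingleton (n := 3) _ n hn _
  -- Two surjections from `Hom(A, A)`, onto `Ext²` and onto `K`, with the same kernel by `hsub`.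
  · let θ : (A →ₗ[A] A) →+ Ext (trivialModule 𝒜) (ModuleCat.of A A) 2 :=
      (spliceExt hq hp (ModuleCat.of A A)).comp
        (ModuleCat.homAddEquiv (M := ModuleCat.of A A) (N := ModuleCat.of A A)).symm.toAddMonoidHom
    let η : (A →ₗ[A] A) →+ K :=
      { toFun := fun f => augmentation 𝒜 (f 1), map_zero' := by simp, map_add' := by simp }
    have hθ : Function.Surjective θ := fun α => by
      obtain ⟨f, rfl⟩ := spliceExt_surjective hq hp _ α
      exact ⟨f.hom, rfl⟩
    have hη : Function.Surjective η := fun r =>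
      ⟨LinearMap.toSpanSingleton A A (algebraMap K A r), by
        simpa [η] using augmentation_algebraMap 𝒜 r⟩
    have hker : θ.ker = η.ker := by
      ext f
      exact hsub f
    let e := (QuotientAddGroup.quotientKerEquivOfSurjective θ hθ).symm.trans
      ((QuotientAddGroup.quotientAddEquivOfEq hker).trans
        (QuotientAddGroup.quotientKerEquivOfSurjective η hη))
    have he (f) : e (θ f) = η f := by
      have : (QuotientAddGroup.quotientKerEquivOfSurjective θ hθ).symm (θ f) =
          QuotientAddGroup.mk f := by
        rw [AddEquiv.symm_apply_eq]; rfl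
      simp only [e, AddEquiv.trans_apply, this]
      rfl
    refine ⟨e, fun α a => ?_⟩
    obtain ⟨f, rfl⟩ := hθ α
    have : extRightAction (θ f) a = θ (LinearMap.toSpanSingleton A A a ∘ₗ f) :=
      spliceExt_comp hq hp _ _
    rw [this, he, he]
    simp [η]

end ConnectedGraded

/-! ### Derivations and exactness for one quadratic relation -/

namespace QuadraticAlg

variable {K : Type u} [Field K] {ι : Type} [Fintype ι]

/-- The universal property maps the algebra into the subalgebra, and composing with the inclusion
gives the identity. -/
theorem adjoin_range_gen (R : Submodule K (Matrix ι ι K)) :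
    Algebra.adjoin K (Set.range (gen R)) = ⊤ := by
  let S := Algebra.adjoin K (Set.range (gen R))
  let g : ι → S := fun μ => ⟨gen R μ, Algebra.subset_adjoin ⟨μ, rfl⟩⟩
  have hg : ∀ B ∈ R, ∑ μ, ∑ ν, B μ ν • (g μ * g ν) = 0 := fun B hB => by
    apply Subtype.ext
    simpa [g] using sum_gen_mul_gen R hB
  have h : S.val.comp (lift R g hg) = AlgHom.id K _ :=
    hom_ext R fun μ => by simp [lift_gen, g]
  refine eq_top_iff.2 fun a _ => ?_
  have := AlgHom.congr_fun h a
  rw [AlgHom.comp_apply, AlgHom.id_apply] at this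
  exact this ▸ (lift R g hg a).2

/-- The algebra `A` is generated by the elements `x μ` with the single relation
`∑ μ ν, B μ ν * x μ * x ν = 0`. -/
structure IsPresentedBy {A : Type u} [Ring A] [Algebra K A] (x : ι → A) (B : Matrix ι ι K) :
    Prop where
  adjoin_eq_top : Algebra.adjoin K (Set.range x) = ⊤
  relation : ∑ μ, ∑ ν, B μ ν • (x μ * x ν) = 0
  exists_lift : ∀ (C : Type u) [Ring C] [Algebra K C] (y : ι → C),
    ∑ μ, ∑ ν, B μ ν • (y μ * y ν) = 0 → ∃ f : A →ₐ[K] C, ∀ μ, f (x μ) = y μ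

theorem IsPresentedBy.induction {A : Type u} [Ring A] [Algebra K A] {x : ι → A}
    {B : Matrix ι ι K} (hx : IsPresentedBy x B) {p : A → Prop} (gen : ∀ μ, p (x μ))
    (algebraMap : ∀ r, p (algebraMap K _ r)) (add : ∀ a c, p a → p c → p (a + c))
    (mul : ∀ a c, p a → p c → p (a * c)) (a : A) : p a := by
  have ha : a ∈ Algebra.adjoin K (Set.range x) := hx.adjoin_eq_top ▸ Algebra.mem_top
  induction ha using Algebra.adjoin_induction with
  | mem a ha => obtain ⟨μ, rfl⟩ := ha; exact gen μ
  | algebraMap r => exact algebraMap r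
  | add a c _ _ iha ihc => exact add a c iha ihc
  | mul a c _ _ iha ihc => exact mul a c iha ihc

/-- A derivation with values in the bimodule `Hom_K(M, Q)` is defined by its values on the
generators, provided that it is compatible with the relation. -/
theorem exists_derivation {A : Type u} [Ring A] [Algebra K A] {x : ι → A}
    {B : Matrix ι ι K} (hx : IsPresentedBy x B) {M Q : Type u} [AddCommGroup M] [Module K M]
    [AddCommGroup Q] [Module K Q] [Module A Q] [IsScalarTower K A Q]
    (σ : A →ₐ[K] Module.End K M) (D : ι → M →ₗ[K] Q)
    (hD : ∀ m, ∑ μ, ∑ ν, B μ ν •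
      (x μ • D ν m + D μ (σ (x ν) m)) = 0) :
    ∃ E : A →ₗ[K] M →ₗ[K] Q, (∀ μ, E (x μ) = D μ) ∧
      ∀ a c m, E (a * c) m = a • E c m + E a (σ c m) := by
  -- A derivation is the off-diagonal entry of a triangular representation on `M × Q`; the relation
  -- holds on the diagonal for free and off the diagonal by `hD`.
  let X : ι → Module.End K (M × Q) := fun μ =>
    (σ (x μ) ∘ₗ LinearMap.fst K M Q).prod
      (Algebra.lsmul K K Q (x μ) ∘ₗ LinearMap.snd K M Q + D μ ∘ₗ LinearMap.fst K M Q)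
  have hX : ∑ μ, ∑ ν, B μ ν • (X μ * X ν) = 0 := by
    refine LinearMap.ext fun z => Prod.ext ?_ ?_
    · have h : σ (∑ μ, ∑ ν, B μ ν • (x μ * x ν)) z.1 = 0 := by
        rw [hx.relation, map_zero, LinearMap.zero_apply]
      simpa [X, LinearMap.sum_apply, Prod.fst_sum] using h
    · have h : ∑ μ, ∑ ν, B μ ν • (x μ • x ν • z.2) = 0 := by
        rw [← zero_smul A z.2, ← hx.relation]
        simp only [Finset.sum_smul, smul_assoc, mul_smul]
      calc ((∑ μ, ∑ ν, B μ ν • (X μ * X ν)) z).2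
          = (∑ μ, ∑ ν, B μ ν • (x μ • x ν • z.2)) +
            ∑ μ, ∑ ν, B μ ν • (x μ • D ν z.1 + D μ (σ (x ν) z.1)) := by
            simp only [← Finset.sum_add_distrib, ← smul_add]
            simp [X, LinearMap.sum_apply, Prod.snd_sum, add_assoc]
        _ = ((0 : Module.End K (M × Q)) z).2 := by rw [h, hD, add_zero]; rfl
  obtain ⟨ρ, hρ⟩ := hx.exists_lift _ X hX
  let E : A →ₗ[K] M →ₗ[K] Q :=
    { toFun := fun a => LinearMap.snd K M Q ∘ₗ ρ a ∘ₗ LinearMap.inl K M Q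
      map_add' := fun a c => by ext; simp
      map_smul' := fun r a => by ext; simp }
  have key (a : A) : ∀ m q, ρ a (m, q) = (σ a m, a • q + E a m) := by
    induction a using hx.induction with
    | gen μ => intro m q; simp [E, hρ, X]
    | algebraMap r => intro m q; simp [E, Module.algebraMap_end_apply]
    | add a c ha hc =>
      intro m q
      simp [ha, hc, add_smul]
      abel
    | mul a c ha hc =>
      intro m q
      have : E (a * c) m = a • E c m + E a (σ c m) := by
        change (ρ (a * c) (m, 0)).2 = _
        rw [map_mul, Module.End.mul_apply, hc, ha]
        simp
      rw [this, map_mul, Module.End.mul_apply, hc, ha, map_mul, Module.End.mul_apply, smul_add,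
        mul_smul, add_assoc]
  refine ⟨E, fun μ => ?_, fun a c m => ?_⟩
  · ext m
    simp [E, hρ, X]
  · change (ρ (a * c) (m, 0)).2 = _
    rw [map_mul, Module.End.mul_apply, key, key]
    simp

section OneRelation

variable (B : Matrix ι ι K)

/-- The quadratic algebra with the single relation `∑ μ ν, B μ ν * x μ * x ν = 0`. -/
abbrev OneRel : Type u := QuadraticAlg (Submodule.span K {B})

/-- The generators of the quadratic algebra with a single relation. -/
noncomputable abbrev oneRelGen (μ : ι) : OneRel B := gen (Submodule.span K {B}) μ

/-- The left coefficient `∑ μ, B μ ν * x μ` of the generator `x ν` in the relation. -/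
noncomputable def leftCoeff (ν : ι) : OneRel B := ∑ μ, B μ ν • oneRelGen B μ

theorem oneRel_relation : ∑ μ, ∑ ν, B μ ν • (oneRelGen B μ * oneRelGen B ν) = 0 :=
  sum_gen_mul_gen _ (Submodule.mem_span_singleton_self B)

theorem sum_leftCoeff_mul_gen : ∑ ν, leftCoeff B ν * oneRelGen B ν = 0 := by
  rw [← oneRel_relation B, Finset.sum_comm]
  simp [leftCoeff, Finset.sum_mul]

theorem leftCoeff_mem (ν : ι) : leftCoeff B ν ∈ grading (Submodule.span K {B}) 1 :=
  Submodule.sum_mem _ fun μ _ => Submodule.smul_mem _ _ (gen_mem _ μ)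

variable {B}

/-- Elements that satisfy the relation define an algebra homomorphism. -/
noncomputable def oneRelLift {C : Type*} [Semiring C] [Algebra K C] (y : ι → C)
    (hy : ∑ μ, ∑ ν, B μ ν • (y μ * y ν) = 0) : OneRel B →ₐ[K] C :=
  lift (Submodule.span K {B}) y (by
    intro B' hB'
    obtain ⟨r, rfl⟩ := Submodule.mem_span_singleton.1 hB'
    simp_rw [Matrix.smul_apply, smul_eq_mul, mul_smul, ← Finset.smul_sum]
    rw [hy, smul_zero])

theorem oneRelLift_gen {C : Type*} [Semiring C] [Algebra K C] (y : ι → C)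
    (hy : ∑ μ, ∑ ν, B μ ν • (y μ * y ν) = 0) (μ : ι) :
    oneRelLift y hy (oneRelGen B μ) = y μ :=
  lift_gen (Submodule.span K {B}) y _ μ

theorem isPresentedBy_oneRel (B : Matrix ι ι K) : IsPresentedBy (oneRelGen B) B where
  adjoin_eq_top := adjoin_range_gen _
  relation := oneRel_relation B
  exists_lift _ _ _ y hy := ⟨oneRelLift y hy, oneRelLift_gen y hy⟩

/-- The condition `he` is what a derivation `E` with `E (a * c) = a • E c + ε(c) • E a` needs in
order to take the value `e` of the `μ`-th basis vector at `x^μ`. Then `E (∑ a_μ x^μ) = e a`, as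
generators have augmentation zero. -/
theorem map_eq_zero_of_map_leftCoeff_eq_zero {Q : Type u} [AddCommGroup Q] [Module K Q]
    [Module (OneRel B) Q] [IsScalarTower K (OneRel B) Q]
    (e : (ι → OneRel B) →ₗ[OneRel B] Q) (he : e (leftCoeff B) = 0) {a : ι → OneRel B}
    (ha : ∑ μ, a μ * oneRelGen B μ = 0) : e a = 0 := by
  classical
  have hsum : ∑ μ, ∑ ν, B μ ν • (oneRelGen B μ • e (Pi.single ν 1)) = 0 := by
    rw [← he, Finset.sum_comm]
    simp_rw [← map_smul, ← LinearMap.map_smul_of_tower, ← map_sum]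
    congr 1
    funext ν
    simp [leftCoeff, Pi.single_apply, Finset.sum_apply]
  obtain ⟨E, hE, hmul⟩ := exists_derivation (isPresentedBy_oneRel B) (M := K) (Q := Q)
    (oneRelLift (fun _ => 0) (by simp)) (fun μ => LinearMap.toSpanSingleton K _
      (e (Pi.single μ 1))) (fun r => by
        simp only [oneRelLift_gen, LinearMap.zero_apply, map_zero, add_zero,
          LinearMap.toSpanSingleton_apply]
        have h3 := congrArg (r • ·) hsum
        simp only [smul_zero, Finset.smul_sum] at h3
        rw [← h3]
        refine Finset.sum_congr rfl fun μ _ => Finset.sum_congr rfl fun ν _ => ?_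
        rw [smul_comm r (B μ ν), smul_comm r])
  have h := congrArg (fun t => E t 1) ha
  simp only [map_sum, LinearMap.sum_apply, hmul, hE, oneRelLift_gen, LinearMap.zero_apply,
    map_zero, add_zero, LinearMap.toSpanSingleton_apply, one_smul] at h
  simp_rw [← map_smul] at h
  rw [← map_sum] at h
  rw [← h]
  congr 1
  funext ν
  simp [Finset.sum_apply, Pi.single_apply]

/-- The universal choice of `Q` in the previous lemma is the quotient by the line `A v`. Nothing is
asked of `B` here. -/
theorem exists_eq_mul_leftCoeff {a : ι → OneRel B} (ha : ∑ μ, a μ * oneRelGen B μ = 0) :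
    ∃ d, ∀ ν, a ν = d * leftCoeff B ν := by
  let N : Submodule (OneRel B) (ι → OneRel B) := Submodule.span _ {leftCoeff B}
  have h := map_eq_zero_of_map_leftCoeff_eq_zero N.mkQ (by
    rw [Submodule.mkQ_apply, Submodule.Quotient.mk_eq_zero]
    exact Submodule.mem_span_singleton_self _) ha
  rw [Submodule.mkQ_apply, Submodule.Quotient.mk_eq_zero, Submodule.mem_span_singleton] at h
  obtain ⟨d, hd⟩ := h
  exact ⟨d, fun ν => (congrFun hd ν).symm⟩

/-- A linear form in at least two variables has a nontrivial zero; this is how the assumption `s ≥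
1` enters. -/
theorem exists_ne_zero_sum_mul_eq_zero [Nontrivial ι] (t : ι → K) :
    ∃ f : ι → K, f ≠ 0 ∧ ∑ ν, f ν * t ν = 0 := by
  classical
  obtain ⟨α, β, h⟩ := exists_pair_ne ι
  by_cases hα : t α = 0
  · exact ⟨Pi.single α 1, by simp, by simp [Pi.single_apply, hα]⟩
  · refine ⟨Pi.single β (t α) - Pi.single α (t β), fun hf => hα ?_, ?_⟩
    · simpa [h.symm] using congrFun hf β
    · simp [Pi.single_apply, sub_mul, Finset.sum_sub_distrib]
      ring

/-! ### Regularity of nonzero linear forms -/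

section Regular

variable [DecidableEq ι] (hB : B.det ≠ 0)
include hB

theorem eq_zero_of_sum_smul_eq_zero {V : Type*} [AddCommGroup V] [Module K V] {w : ι → V}
    (hw : ∀ μ, ∑ ν, B μ ν • w ν = 0) (ν : ι) : w ν = 0 := by
  have h : ∑ μ, B⁻¹ ν μ • ∑ l, B μ l • w l = w ν := by
    simp_rw [Finset.smul_sum, smul_smul]
    rw [Finset.sum_comm]
    simp_rw [← Finset.sum_smul, ← Matrix.mul_apply,
      Matrix.nonsing_inv_mul B (isUnit_iff_ne_zero.2 hB)]
    simp [Matrix.one_apply]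
  rw [← h]
  simp [hw]

theorem oneRelGen_eq_sum_leftCoeff (μ : ι) :
    oneRelGen B μ = ∑ ν, B⁻¹ ν μ • leftCoeff B ν := by
  simp_rw [leftCoeff, Finset.smul_sum, smul_smul]
  rw [Finset.sum_comm]
  simp_rw [mul_comm (B⁻¹ _ _), ← Finset.sum_smul, ← Matrix.mul_apply,
    Matrix.mul_nonsing_inv B (isUnit_iff_ne_zero.2 hB)]
  simp [Matrix.one_apply]

variable [Nontrivial ι]

/-- Exactness gives `t_ν c = d v_ν` with `d` one degree lower. For `f ≠ 0` orthogonal to `t`, the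
linear form `∑ f_ν v_ν` has the coefficients `B f ≠ 0` and is killed by `d` on the left, so `d = 0`
by induction. -/
theorem eq_zero_of_mem_of_mul_linearCombination_eq_zero {n : ℕ} {c : OneRel B}
    (hc : c ∈ grading (Submodule.span K {B}) n) {t : ι → K} (ht : t ≠ 0)
    (h : c * ∑ μ, t μ • oneRelGen B μ = 0) : c = 0 := by
  induction n generalizing c t with
  | zero =>
    obtain ⟨d, hd⟩ := exists_eq_mul_leftCoeff (B := B) (a := fun μ => t μ • c) (by
      rw [← h, Finset.mul_sum]; simp)
    obtain ⟨ν, hν⟩ := Function.ne_iff.1 ht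
    have h0 : t ν • c = 0 := by
      rw [← DirectSum.decompose_of_mem_same (grading (Submodule.span K {B}))
        (Submodule.smul_mem _ (t ν) hc), hd]
      exact DirectSum.coe_decompose_mul_of_right_mem_of_not_le _ (leftCoeff_mem B ν) (by simp)
    exact (smul_eq_zero.1 h0).resolve_left hν
  | succ n ih =>
    obtain ⟨d, hd⟩ := exists_eq_mul_leftCoeff (B := B) (a := fun μ => t μ • c) (by
      rw [← h, Finset.mul_sum]; simp)
    obtain ⟨ν, hν⟩ := Function.ne_iff.1 ht
    obtain ⟨f, hf, hft⟩ := exists_ne_zero_sum_mul_eq_zero t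
    -- Exactness does not make `d` homogeneous; only its component of degree `n` contributes to
    -- degree `n + 1`.
    let d' : OneRel B := DirectSum.decompose (grading (Submodule.span K {B})) d n
    have hd' (ν : ι) : t ν • c = d' * leftCoeff B ν := by
      rw [← decompose_mul_of_mem _ (leftCoeff_mem B ν), ← hd,
        DirectSum.decompose_of_mem_same _ (Submodule.smul_mem _ (t ν) hc)]
    have h0 : d' = 0 := by
      refine ih (SetLike.coe_mem _) (t := B.mulVec f)
        (fun h0 => hf (Matrix.eq_zero_of_mulVec_eq_zero hB h0)) ?_
      calc d' * ∑ μ, B.mulVec f μ • oneRelGen B μ = ∑ ν, f ν • (d' * leftCoeff B ν) := by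
            simp_rw [leftCoeff, Matrix.mulVec, dotProduct, Finset.sum_smul, Finset.mul_sum,
              Finset.smul_sum]
            rw [Finset.sum_comm]
            simp [mul_smul, smul_comm (f _)]
        _ = 0 := by
            simp_rw [← hd', smul_smul]
            rw [← Finset.sum_smul, hft, zero_smul]
    have := hd' ν
    rw [h0, zero_mul] at this
    exact (smul_eq_zero.1 this).resolve_left hν

/-- A nonzero linear combination of the generators is not a right zero divisor. -/
theorem eq_zero_of_mul_linearCombination_eq_zero {c : OneRel B} {t : ι → K} (ht : t ≠ 0)
    (h : c * ∑ μ, t μ • oneRelGen B μ = 0) : c = 0 := by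
  have hv : ∑ μ, t μ • oneRelGen B μ ∈ grading (Submodule.span K {B}) 1 :=
    Submodule.sum_mem _ fun μ _ => Submodule.smul_mem _ _ (gen_mem _ μ)
  apply (DirectSum.decompose (grading (Submodule.span K {B}))).injective
  ext n
  rw [DirectSum.decompose_zero]
  refine eq_zero_of_mem_of_mul_linearCombination_eq_zero hB (SetLike.coe_mem _) ht ?_
  rw [← decompose_mul_of_mem _ hv, h]
  simp

theorem eq_zero_of_mul_leftCoeff_eq_zero {c : OneRel B} {ν : ι} (h : c * leftCoeff B ν = 0) :
    c = 0 := by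
  refine eq_zero_of_mul_linearCombination_eq_zero hB (t := fun μ => B μ ν) (fun h0 => hB ?_) h
  exact Matrix.det_eq_zero_of_column_eq_zero ν (congrFun h0)

theorem eq_zero_of_mul_gen_eq_zero {c : OneRel B} {ν : ι} (h : c * oneRelGen B ν = 0) :
    c = 0 := by
  refine eq_zero_of_mul_linearCombination_eq_zero hB (t := Pi.single ν 1) (by simp) ?_
  simpa [Pi.single_apply] using h

end Regular

/-- The antihomomorphism to the algebra of the transposed matrix that fixes the generators. -/
noncomputable def oneRelReverse {B C : Matrix ι ι K} (h : ∀ μ ν, C μ ν = B ν μ) :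
    OneRel B →ₗ[K] OneRel C :=
  (MulOpposite.opLinearEquiv K).symm.toLinearMap ∘ₗ
    (oneRelLift (fun μ => MulOpposite.op (oneRelGen C μ)) (by
      have hC := oneRel_relation C
      rw [Finset.sum_comm] at hC
      simp_rw [h] at hC
      simp_rw [← MulOpposite.op_mul, ← MulOpposite.op_smul, ← Finset.op_sum, hC,
        MulOpposite.op_zero]) : OneRel B →ₐ[K] (OneRel C)ᵐᵒᵖ).toLinearMap

section Reverse

variable {C : Matrix ι ι K} (h : ∀ μ ν, C μ ν = B ν μ)

theorem oneRelReverse_gen (μ : ι) : oneRelReverse h (oneRelGen B μ) = oneRelGen C μ := by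
  rw [oneRelReverse, LinearMap.comp_apply, AlgHom.toLinearMap_apply, oneRelLift_gen]
  rfl

theorem oneRelReverse_algebraMap (r : K) :
    oneRelReverse h (algebraMap K _ r) = algebraMap K _ r := by
  rw [oneRelReverse, LinearMap.comp_apply, AlgHom.toLinearMap_apply, AlgHom.commutes]
  rfl

theorem oneRelReverse_mul (a c : OneRel B) :
    oneRelReverse h (a * c) = oneRelReverse h c * oneRelReverse h a := by
  simp only [oneRelReverse, LinearMap.comp_apply, AlgHom.toLinearMap_apply, map_mul]
  rfl

theorem oneRelReverse_reverse (h' : ∀ μ ν, B μ ν = C ν μ) (a : OneRel B) :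
    oneRelReverse h' (oneRelReverse h a) = a := by
  induction a using (isPresentedBy_oneRel B).induction with
  | gen μ => rw [oneRelReverse_gen, oneRelReverse_gen]
  | algebraMap r => rw [oneRelReverse_algebraMap, oneRelReverse_algebraMap]
  | add a c ha hc => rw [map_add, map_add, ha, hc]
  | mul a c ha hc => rw [oneRelReverse_mul, oneRelReverse_mul, ha, hc]

end Reverse

/-! ### The mirror complex of right modules -/

section RightHanded

variable [DecidableEq ι] (hB : B.det ≠ 0)
include hB

/-- After reversal the hypothesis is a relation between the generators for the transposed matrix,
with coefficients `∑_ν B_{μν} b_ν`. These are multiples `d ∑_ν B_{μν} x^ν` by exactness there, and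
inverting `B` gives `b_ν = d x^ν`. -/
theorem exists_eq_gen_mul {a : ι → OneRel B} (ha : ∑ ν, leftCoeff B ν * a ν = 0) :
    ∃ d, ∀ ν, a ν = oneRelGen B ν * d := by
  obtain ⟨C, hC⟩ : ∃ C : Matrix ι ι K, ∀ μ ν, C μ ν = B ν μ := ⟨B.transpose, fun _ _ => rfl⟩
  let b : ι → OneRel C := fun ν => oneRelReverse hC (a ν)
  have h : ∑ μ, (∑ ν, B μ ν • b ν) * oneRelGen C μ = 0 := by
    have h := congrArg (oneRelReverse hC) ha
    simp only [map_sum, oneRelReverse_mul, map_zero, leftCoeff, map_smul, oneRelReverse_gen,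
      Finset.mul_sum] at h
    rw [Finset.sum_comm] at h
    simpa [b, Finset.sum_mul] using h
  obtain ⟨d, hd⟩ := exists_eq_mul_leftCoeff h
  have hb (ν) : b ν - d * oneRelGen C ν = 0 := by
    refine eq_zero_of_sum_smul_eq_zero hB (w := fun ν => b ν - d * oneRelGen C ν)
      (fun μ => ?_) ν
    simp [smul_sub, Finset.sum_sub_distrib, hd, leftCoeff, Finset.mul_sum, hC]
  refine ⟨oneRelReverse (fun μ ν => (hC ν μ).symm) d, fun ν => ?_⟩
  rw [← oneRelReverse_reverse hC (fun μ ν => (hC ν μ).symm) (a ν),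
    show oneRelReverse hC (a ν) = b ν from rfl, sub_eq_zero.1 (hb ν), oneRelReverse_mul,
    oneRelReverse_gen]

theorem eq_zero_of_gen_mul_eq_zero [Nontrivial ι] {c : OneRel B} {ν : ι}
    (h : oneRelGen B ν * c = 0) : c = 0 := by
  have hC : ∀ μ ν, B.transpose μ ν = B ν μ := fun _ _ => rfl
  rw [← oneRelReverse_reverse hC (fun μ ν => (hC ν μ).symm) c]
  rw [eq_zero_of_mul_gen_eq_zero (by rwa [Matrix.det_transpose]) (c := oneRelReverse hC c)
    (ν := ν), map_zero]
  rw [← oneRelReverse_gen hC, ← oneRelReverse_mul, h, map_zero]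

/-- Reversal writes `A_+` as the right ideal of the generators, and these are combinations of the
`v_ν` because `B` is invertible. -/
theorem augmentation_eq_zero_iff_exists_leftCoeff (a : OneRel B) :
    augmentation (grading (Submodule.span K {B})) a = 0 ↔
      ∃ c : ι → OneRel B, a = ∑ ν, leftCoeff B ν * c ν := by
  constructor
  · intro ha
    obtain ⟨C, hC⟩ : ∃ C : Matrix ι ι K, ∀ μ ν, C μ ν = B ν μ := ⟨B.transpose, fun _ _ => rfl⟩
    have hC' : ∀ μ ν, B μ ν = C ν μ := fun μ ν => (hC ν μ).symm
    obtain ⟨r, c, hc⟩ := exists_eq_algebraMap_add_sum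
      (adjoin_range_gen (Submodule.span K {C})) (oneRelReverse hC a)
    have h : a = algebraMap K _ r + ∑ μ, oneRelGen B μ * oneRelReverse hC' (c μ) := by
      rw [← oneRelReverse_reverse hC hC' a, hc]
      simp only [map_add, map_sum, oneRelReverse_mul, oneRelReverse_gen, oneRelReverse_algebraMap]
    have hr : r = 0 := by
      rw [h, map_add, augmentation_algebraMap, map_sum] at ha
      simpa [augmentation_of_mem _ one_ne_zero (gen_mem _ _)] using ha
    refine ⟨fun ν => ∑ μ, B⁻¹ ν μ • oneRelReverse hC' (c μ), ?_⟩
    rw [h, hr, map_zero, zero_add]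
    simp_rw [Finset.mul_sum]
    rw [Finset.sum_comm]
    refine Finset.sum_congr rfl fun μ _ => ?_
    rw [oneRelGen_eq_sum_leftCoeff hB, Finset.sum_mul]
    simp
  · rintro ⟨c, rfl⟩
    simp [augmentation_of_mem _ one_ne_zero (leftCoeff_mem B _)]

end RightHanded

theorem isGorenstein_oneRel [Nontrivial ι] [DecidableEq ι] (hB : B.det ≠ 0) :
    IsGorenstein (grading (Submodule.span K {B})) 2 :=
  isGorenstein_two_of_exact _ (gen_mem _) (adjoin_range_gen _) (leftCoeff B)
    (fun _ h => eq_zero_of_mul_leftCoeff_eq_zero hB (h (Classical.arbitrary ι)))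
    (sum_leftCoeff_mul_gen B) (fun _ h => exists_eq_mul_leftCoeff h)
    (fun _ h => eq_zero_of_gen_mul_eq_zero hB (h (Classical.arbitrary ι)))
    (fun _ h => exists_eq_gen_mul hB h) (augmentation_eq_zero_iff_exists_leftCoeff hB)

end OneRelation

end QuadraticAlg

/-! ### A free resolution of every module and the global dimension -/

namespace QuadraticAlg

variable {K : Type u} [Field K] {ι : Type} [Fintype ι]

section TensorResolution

variable {A : Type u} [Ring A] [Algebra K A] (x : ι → A) (B : Matrix ι ι K)

/-- The linear combinations of the elements `x μ` given by the columns of a matrix. -/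
noncomputable def colComb (ν : ι) : A := ∑ μ, B μ ν • x μ

/-- The linear combinations of the elements `x ν` given by the rows of a matrix. -/
noncomputable def rowComb (μ : ι) : A := ∑ ν, B μ ν • x ν

variable {x B}

theorem IsPresentedBy.sum_colComb_mul (hx : IsPresentedBy x B) : ∑ ν, colComb x B ν * x ν = 0 := by
  rw [← hx.relation, Finset.sum_comm]
  simp [colComb, Finset.sum_mul]

theorem IsPresentedBy.sum_mul_rowComb (hx : IsPresentedBy x B) : ∑ μ, x μ * rowComb x B μ = 0 := by
  rw [← hx.relation]
  simp [rowComb, Finset.mul_sum]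

variable {M : Type u} [AddCommGroup M] [Module A M] [Module K M] [IsScalarTower K A M]

variable (K M) in
/-- Right multiplication by `v` on the first factor of `A ⊗ M`. -/
noncomputable def tensorMulRight (v : A) : A ⊗[K] M →ₗ[A] A ⊗[K] M :=
  TensorProduct.AlgebraTensorModule.map (LinearMap.toSpanSingleton (A) (A) v)
    LinearMap.id

variable (K M) in
/-- The action of `v` on the second factor of `A ⊗ M`. -/
noncomputable def tensorSMul (v : A) : A ⊗[K] M →ₗ[A] A ⊗[K] M :=
  TensorProduct.AlgebraTensorModule.map LinearMap.id (Algebra.lsmul K K M v)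

omit [Module A M] [IsScalarTower K A M] in
@[simp]
theorem tensorMulRight_tmul (v a : A) (m : M) :
    tensorMulRight K M v (a ⊗ₜ m) = (a * v) ⊗ₜ m := rfl

@[simp]
theorem tensorSMul_tmul (v a : A) (m : M) :
    tensorSMul K M v (a ⊗ₜ m) = a ⊗ₜ (v • m) := rfl

variable (K A M) in
/-- The map `A ⊗ M → M` given by the action. -/
noncomputable def tensorAction : A ⊗[K] M →ₗ[A] M :=
  TensorProduct.AlgebraTensorModule.lift
    { toFun := fun a => Algebra.lsmul K K M a
      map_add' := fun a c => map_add _ a c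
      map_smul' := fun a c => by ext m; exact mul_smul a c m }

@[simp]
theorem tensorAction_tmul (a : A) (m : M) : tensorAction K A M (a ⊗ₜ m) = a • m := rfl

variable (K x M) in
/-- The map `a ⊗ m ↦ a x^μ ⊗ m - a ⊗ x^μ m` on the component `μ` of `(A ⊗ M)^ι`. -/
noncomputable def tensorRes₁ : (ι → A ⊗[K] M) →ₗ[A] A ⊗[K] M :=
  ∑ μ, (tensorMulRight K M (x μ) - tensorSMul K M (x μ)) ∘ₗ LinearMap.proj μ

variable (x B M) in
/-- The map `a ⊗ m ↦ a B_{μν} x^μ ⊗ m + a ⊗ B_{νμ} x^μ m` with components `ν`. -/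
noncomputable def tensorRes₂ : A ⊗[K] M →ₗ[A] (ι → A ⊗[K] M) :=
  LinearMap.pi fun ν => tensorMulRight K M (colComb x B ν) + tensorSMul K M (rowComb x B ν)

theorem tensorRes₁_apply (t : ι → A ⊗[K] M) :
    tensorRes₁ K x M t =
      ∑ μ, (tensorMulRight K M (x μ) (t μ) - tensorSMul K M (x μ) (t μ)) := by
  simp [tensorRes₁, LinearMap.sum_apply]

theorem tensorRes₁_single [DecidableEq ι] (μ : ι) (t : A ⊗[K] M) :
    tensorRes₁ K x M (Pi.single μ t) =
      tensorMulRight K M (x μ) t - tensorSMul K M (x μ) t := by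
  rw [tensorRes₁_apply, Finset.sum_eq_single μ]
  · simp
  · intro ν _ h; simp [h]
  · simp

theorem tensorRes₂_apply (t : A ⊗[K] M) (ν : ι) :
    tensorRes₂ x B M t ν = tensorMulRight K M (colComb x B ν) t + tensorSMul K M (rowComb x B ν) t :=
  rfl

theorem tensorAction_surjective : Function.Surjective (tensorAction K A M) := fun m =>
  ⟨1 ⊗ₜ m, by simp⟩

theorem tensorAction_tensorRes₁ (t : ι → A ⊗[K] M) :
    tensorAction K A M (tensorRes₁ K x M t) = 0 := by
  rw [tensorRes₁_apply, map_sum]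
  refine Finset.sum_eq_zero fun μ _ => ?_
  induction t μ with
  | zero => simp
  | tmul a m => simp [mul_smul]
  | add a c ha hc =>
    rw [map_add, map_add, add_sub_add_comm, map_add, ha, hc, add_zero]

/-- Modulo the image, generators move across the tensor sign; products telescope as `ac ⊗ m - 1 ⊗
acm = a(c ⊗ m - 1 ⊗ cm) + (a ⊗ cm - 1 ⊗ a(cm))`. -/
theorem tmul_sub_mem_range_tensorRes₁ (hx : IsPresentedBy x B) (a : A) (m : M) :
    a ⊗ₜ[K] m - 1 ⊗ₜ[K] (a • m) ∈ LinearMap.range (tensorRes₁ K x M) := by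
  classical
  induction a using hx.induction generalizing m with
  | gen μ => exact ⟨Pi.single μ (1 ⊗ₜ m), by simp [tensorRes₁_single]⟩
  | algebraMap r =>
    rw [algebraMap_smul, Algebra.algebraMap_eq_smul_one, TensorProduct.smul_tmul, sub_self]
    exact Submodule.zero_mem _
  | add a c ha hc =>
    rw [TensorProduct.add_tmul, add_smul, TensorProduct.tmul_add, add_sub_add_comm]
    exact Submodule.add_mem _ (ha m) (hc m)
  | mul a c ha hc =>
    have h := Submodule.add_mem _ (Submodule.smul_mem _ a (hc m)) (ha (c • m))
    rwa [smul_sub, TensorProduct.smul_tmul', TensorProduct.smul_tmul', smul_eq_mul, smul_eq_mul,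
      mul_one, sub_add_sub_cancel, ← mul_smul] at h

theorem exact_tensorRes₁_tensorAction (hx : IsPresentedBy x B) :
    Function.Exact (tensorRes₁ K x M) (tensorAction K A M) := by
  intro t
  constructor
  · intro ht
    have h : t - 1 ⊗ₜ[K] (tensorAction K A M t) ∈ LinearMap.range (tensorRes₁ K x M) := by
      clear ht
      induction t with
      | zero => simp
      | tmul a m => exact tmul_sub_mem_range_tensorRes₁ hx a m
      | add a c ha hc =>
        rw [map_add, TensorProduct.tmul_add, add_sub_add_comm]
        exact Submodule.add_mem _ ha hc
    rwa [ht, TensorProduct.tmul_zero, sub_zero] at h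
  · rintro ⟨s, rfl⟩
    exact tensorAction_tensorRes₁ s

theorem tensorRes₂_one_tmul [DecidableEq ι] (m : M) :
    tensorRes₂ x B M (1 ⊗ₜ m) =
      ∑ μ, ∑ ν, B μ ν • (x μ • (Pi.single ν ((1 : A) ⊗ₜ[K] m) : ι → A ⊗[K] M) +
        (Pi.single μ ((1 : A) ⊗ₜ[K] (x ν • m)) : ι → A ⊗[K] M)) := by
  simp only [smul_add, Finset.sum_add_distrib]
  rw [Finset.sum_comm]
  funext l
  simp only [tensorRes₂_apply, tensorMulRight_tmul, tensorSMul_tmul, one_mul, colComb,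
    rowComb, Pi.add_apply, Finset.sum_apply, Pi.smul_apply, Pi.single_apply, smul_ite, smul_zero]
  congr 1
  · simp [TensorProduct.sum_tmul, TensorProduct.smul_tmul']
  · simp [Finset.sum_ite_irrel, Finset.sum_smul, TensorProduct.tmul_sum]

theorem tensorRes₁_tensorRes₂ (hx : IsPresentedBy x B) (t : A ⊗[K] M) : tensorRes₁ K x M (tensorRes₂ x B M t) = 0 := by
  suffices h : ∀ m : M, tensorRes₁ K x M (tensorRes₂ x B M (1 ⊗ₜ m)) = 0 by
    induction t with
    | zero => simp
    | tmul a m =>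
      rw [← mul_one a, ← smul_eq_mul, ← TensorProduct.smul_tmul', map_smul, map_smul, h, smul_zero]
    | add a c ha hc => rw [map_add, map_add, ha, hc, add_zero]
  intro m
  simp only [tensorRes₁_apply, tensorRes₂_apply, map_add, tensorMulRight_tmul, tensorSMul_tmul,
    one_mul]
  have h1 : ∑ ν, (colComb x B ν * x ν) ⊗ₜ[K] m = 0 := by
    rw [← TensorProduct.sum_tmul, hx.sum_colComb_mul, TensorProduct.zero_tmul]
  have h2 : ∑ ν, (1 : A) ⊗ₜ[K] (x ν • rowComb x B ν • m) = 0 := by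
    simp_rw [← TensorProduct.tmul_sum, ← mul_smul, ← Finset.sum_smul, hx.sum_mul_rowComb,
      zero_smul, TensorProduct.tmul_zero]
  -- The cross terms of the composite both equal `∑ B_{μν} x^μ ⊗ x^ν m` and cancel.
  have h3 : ∑ ν, x ν ⊗ₜ[K] (rowComb x B ν • m) =
      ∑ ν, colComb x B ν ⊗ₜ[K] (x ν • m) := by
    simp only [colComb, rowComb, TensorProduct.sum_tmul, Finset.sum_smul,
      TensorProduct.tmul_sum, TensorProduct.smul_tmul', smul_assoc, TensorProduct.tmul_smul]
    rw [Finset.sum_comm]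
  simp only [Finset.sum_sub_distrib, Finset.sum_add_distrib, h1, h2, h3]
  abel

/-- Vanishing of `e` on the image of `tensorRes₂` is the compatibility required of a derivation `E`
into `Hom_K(M, Q)` with values `D μ`. The map `a ⊗ m ↦ E a m`, composed with `tensorRes₁`, is then
`e`. -/
theorem map_eq_zero_of_map_tensorRes₂_eq_zero (hx : IsPresentedBy x B) {Q : Type u} [AddCommGroup Q] [Module K Q]
    [Module (A) Q] [IsScalarTower K (A) Q]
    (e : (ι → A ⊗[K] M) →ₗ[A] Q) (he : ∀ t, e (tensorRes₂ x B M t) = 0)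
    {t : ι → A ⊗[K] M} (ht : tensorRes₁ K x M t = 0) : e t = 0 := by
  classical
  let D (μ : ι) : M →ₗ[K] Q := (e.restrictScalars K) ∘ₗ
    (LinearMap.single K (fun _ => A ⊗[K] M) μ) ∘ₗ TensorProduct.mk K (A) M 1
  have hDe (μ m) : D μ m = e (Pi.single μ (1 ⊗ₜ m)) := rfl
  obtain ⟨E, hE, hmul⟩ := exists_derivation hx (Algebra.lsmul K K M) D (fun m => by
    rw [← he (1 ⊗ₜ m), tensorRes₂_one_tmul]
    simp only [map_sum, LinearMap.map_smul_of_tower, map_add, map_smul, hDe, Algebra.lsmul_coe])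
  have key (μ : ι) (s : A ⊗[K] M) :
      TensorProduct.lift E (tensorRes₁ K x M (Pi.single μ s)) = e (Pi.single μ s) := by
    rw [tensorRes₁_single]
    induction s with
    | zero => simp
    | tmul a m =>
      rw [tensorMulRight_tmul, tensorSMul_tmul, map_sub, TensorProduct.lift.tmul,
        TensorProduct.lift.tmul, hmul, hE, Algebra.lsmul_coe, add_sub_cancel_right, hDe, ← map_smul,
        ← Pi.single_smul, TensorProduct.smul_tmul', smul_eq_mul, mul_one]
    | add a c ha hc =>
      rw [map_add, map_add, add_sub_add_comm, map_add, ha, hc, Pi.single_add, map_add]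
  have hsum : TensorProduct.lift E (tensorRes₁ K x M t) = e t := by
    rw [← Finset.univ_sum_single t, map_sum, map_sum, map_sum]
    exact Finset.sum_congr rfl fun μ _ => key μ (t μ)
  rw [← hsum, ht, map_zero]

theorem exact_tensorRes₂_tensorRes₁ (hx : IsPresentedBy x B) : Function.Exact (tensorRes₂ x B M) (tensorRes₁ K x M) := by
  intro t
  constructor
  · intro ht
    have h := map_eq_zero_of_map_tensorRes₂_eq_zero hx (LinearMap.range (tensorRes₂ x B M)).mkQ
      (fun t => by
        rw [Submodule.mkQ_apply, Submodule.Quotient.mk_eq_zero]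
        exact LinearMap.mem_range_self _ t) ht
    rwa [Submodule.mkQ_apply, Submodule.Quotient.mk_eq_zero] at h
  · rintro ⟨s, rfl⟩
    exact tensorRes₁_tensorRes₂ hx s

variable (𝒜 : ℕ → Submodule K A) [GradedAlgebra 𝒜]

variable (M) in
/-- The projection of `A ⊗ M` on the component of degree `n` of the first factor. -/
noncomputable def tensorProj (n : ℕ) : A ⊗[K] M →ₗ[K] A ⊗[K] M :=
  (GradedAlgebra.proj 𝒜 n).rTensor M

omit [Module A M] [IsScalarTower K A M] in
theorem tensorProj_tmul (n : ℕ) (a : A) (m : M) : tensorProj M 𝒜 n (a ⊗ₜ m) =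
    (DirectSum.decompose 𝒜 a n : A) ⊗ₜ m := rfl

omit [Module A M] [IsScalarTower K A M] in
theorem exists_forall_sum_tensorProj_eq (t : A ⊗[K] M) :
    ∃ N, ∀ n ≥ N, ∑ i ∈ Finset.range n, tensorProj M 𝒜 i t = t := by
  classical
  induction t with
  | zero => exact ⟨0, by simp⟩
  | tmul a m =>
    obtain ⟨N, hN⟩ := (DFinsupp.support
      (DirectSum.decompose 𝒜 a)).exists_nat_subset_range
    refine ⟨N, fun n hn => ?_⟩
    simp_rw [tensorProj_tmul, ← TensorProduct.sum_tmul]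
    congr 1
    conv_rhs => rw [← DirectSum.sum_support_decompose 𝒜 a]
    symm
    refine Finset.sum_subset (hN.trans (Finset.range_subset_range.2 hn)) fun i _ hi => ?_
    rw [DFinsupp.notMem_support_iff] at hi
    rw [hi, ZeroMemClass.coe_zero]
  | add a c ha hc =>
    obtain ⟨N, hN⟩ := ha
    obtain ⟨N', hN'⟩ := hc
    refine ⟨max N N', fun n hn => ?_⟩
    simp only [map_add, Finset.sum_add_distrib]
    rw [hN n (le_of_max_le_left hn), hN' n (le_of_max_le_right hn)]

omit [Module A M] [IsScalarTower K A M] in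
theorem tensorProj_tensorMulRight {v : A} (hv : v ∈ 𝒜 1)
    (n : ℕ) (t : A ⊗[K] M) :
    tensorProj M 𝒜 (n + 1) (tensorMulRight K M v t) = tensorMulRight K M v (tensorProj M 𝒜 n t) := by
  induction t with
  | zero => simp
  | tmul a m =>
    rw [tensorMulRight_tmul, tensorProj_tmul, tensorProj_tmul, tensorMulRight_tmul,
      decompose_mul_of_mem _ hv]
  | add a c ha hc => simp only [map_add, ha, hc]

theorem tensorProj_tensorSMul (v : A) (n : ℕ) (t : A ⊗[K] M) :
    tensorProj M 𝒜 n (tensorSMul K M v t) = tensorSMul K M v (tensorProj M 𝒜 n t) := by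
  induction t with
  | zero => simp
  | tmul a m => rw [tensorSMul_tmul, tensorProj_tmul, tensorProj_tmul, tensorSMul_tmul]
  | add a c ha hc => simp only [map_add, ha, hc]

omit [Module A M] [IsScalarTower K A M] in
theorem tensorMulRight_injective {v : A} (hv : ∀ a, a * v = 0 → a = 0) :
    Function.Injective (tensorMulRight K M v) := by
  have h : Function.Injective (LinearMap.mulRight K v) := by
    rw [injective_iff_map_eq_zero]
    exact hv
  have hcoe (t : A ⊗[K] M) : tensorMulRight K M v t = (LinearMap.mulRight K v).rTensor M t := by
    induction t with
    | zero => simp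
    | tmul a m => simp
    | add a c ha hc => rw [map_add, map_add, ha, hc]
  intro s t hst
  rw [hcoe, hcoe] at hst
  exact Module.Flat.rTensor_preserves_injective_linearMap (M := M) _ h hst

/-- Look at the top degree of the first factor: in the component `ν`, one summand raises it by one
through a regular element and the other preserves it, so the top part of a kernel element vanishes.
-/
theorem tensorRes₂_injective (hx1 : ∀ μ, x μ ∈ 𝒜 1) {ν : ι}
    (hν : ∀ a, a * colComb x B ν = 0 → a = 0) : Function.Injective (tensorRes₂ x B M) := by
  rw [injective_iff_map_eq_zero]
  intro t ht
  have hmem : colComb x B ν ∈ 𝒜 1 :=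
    Submodule.sum_mem _ fun μ _ => Submodule.smul_mem _ _ (hx1 μ)
  have hstep (n : ℕ) (hn : tensorProj M 𝒜 (n + 1) t = 0) : tensorProj M 𝒜 n t = 0 := by
    have h := congrArg (tensorProj M 𝒜 (n + 1)) (congrFun ht ν)
    rw [tensorRes₂_apply, map_add, tensorProj_tensorMulRight 𝒜 hmem,
      tensorProj_tensorSMul, hn, map_zero, add_zero, Pi.zero_apply, map_zero] at h
    exact (injective_iff_map_eq_zero _).1 (tensorMulRight_injective hν) _ h
  obtain ⟨N, hN⟩ := exists_forall_sum_tensorProj_eq 𝒜 t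
  have hlarge : tensorProj M 𝒜 N t = 0 := by
    have h := hN (N + 1) N.le_succ
    rwa [Finset.sum_range_succ, hN N le_rfl, add_eq_left] at h
  -- Descending induction from `N`; for `k ≥ N` truncated subtraction stays at degree `0`.
  have hall (k : ℕ) : tensorProj M 𝒜 (N - k) t = 0 := by
    induction k with
    | zero => exact hlarge
    | succ k ih =>
      by_cases hk : k < N
      · exact hstep _ (by rwa [show N - (k + 1) + 1 = N - k by omega])
      · rwa [show N - (k + 1) = N - k by omega]
  rw [← hN N le_rfl]
  refine Finset.sum_eq_zero fun i hi => ?_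
  rw [show i = N - (N - i) by have := Finset.mem_range.1 hi; omega]
  exact hall _

include 𝒜 in
-- Over a field `A ⊗ M` is free as an `A`-module whatever `M` is, so the tensor complex is a free
-- resolution of length `2`.
theorem IsPresentedBy.hasProjectiveDimensionLE_two (hx : IsPresentedBy x B)
    (hx1 : ∀ μ, x μ ∈ 𝒜 1) {ν : ι} (hν : ∀ a, a * colComb x B ν = 0 → a = 0)
    (M : ModuleCat.{u} A) : HasProjectiveDimensionLE M 2 := by
  let _ : Module K M := Module.compHom M (algebraMap K A)
  have : IsScalarTower K A M := ⟨fun r a m => by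
    rw [Algebra.smul_def, mul_smul]; rfl⟩
  have P₀ : Projective (ModuleCat.of A (A ⊗[K] M)) :=
    ModuleCat.projective_of_free (Module.Free.chooseBasis A _)
  have P₁ : Projective (ModuleCat.of A (ι → A ⊗[K] M)) :=
    ModuleCat.projective_of_free (Module.Free.chooseBasis A _)
  exact _root_.hasProjectiveDimensionLE_two
    (shortExact_of_injective_of_exact (tensorRes₂_injective 𝒜 hx1 hν)
      (exact_tensorRes₂_tensorRes₁ hx))
    (shortExact_of_exact_of_surjective (exact_tensorRes₁_tensorAction hx)
      tensorAction_surjective)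

end TensorResolution

/-- The trivial module attains the bound, since `Ext²(K, A) ≅ K` is nonzero. -/
theorem globalDimension_oneRel [DecidableEq ι] [Nontrivial ι] {B : Matrix ι ι K}
    (hB : B.det ≠ 0) : globalDimension (OneRel B) = 2 := by
  apply le_antisymm
  · exact iSup_le fun M => (projectiveDimension_le_iff M 2).2
      ((isPresentedBy_oneRel B).hasProjectiveDimensionLE_two (grading (Submodule.span K {B}))
        (gen_mem _) (ν := Classical.arbitrary ι)
        (fun _ h => eq_zero_of_mul_leftCoeff_eq_zero hB h) M)
  · refine le_trans ?_ (le_iSup _ (trivialModule (grading (Submodule.span K {B}))))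
    refine (projectiveDimension_ge_iff _ 2).2 fun h => ?_
    obtain ⟨-, e, -⟩ := isGorenstein_oneRel hB
    have := HasProjectiveDimensionLT.subsingleton
      (trivialModule (grading (Submodule.span K {B}))) 2 2 le_rfl
      (ModuleCat.of (OneRel B) (OneRel B))
    exact not_subsingleton K (e.symm.injective.subsingleton)

end QuadraticAlg

/-! ### The quadratic dual and the Koszul complex -/

namespace QuadraticAlg

variable {K : Type u} [Field K] {ι : Type} [Fintype ι]

section Contraction

variable (R : Submodule K (Matrix ι ι K))

instance (n : ℕ) : Module.Finite K (grading R n) :=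
  Module.Finite.iff_fg.2 ((Submodule.fg_span (Set.finite_range (gen R))).pow n)

/-- The contraction `a ⊗ φ ↦ (v ↦ φ(v) a)` on the terms of the Koszul complex. -/
noncomputable def contraction (n : ℕ) :
    KoszulModule R n →ₗ[K] DualComponent R n →ₗ[K] QuadraticAlg R :=
  dualTensorHom K (DualComponent R n) (QuadraticAlg R) ∘ₗ
    (TensorProduct.comm K (QuadraticAlg R) (Module.Dual K (DualComponent R n))).toLinearMap

theorem contraction_tmul (n : ℕ) (a : QuadraticAlg R) (φ : Module.Dual K (DualComponent R n))
    (v : DualComponent R n) : contraction R n (a ⊗ₜ φ) v = φ v • a := by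
  simp [contraction, dualTensorHom_apply]

theorem dualTensorHom_submodule_injective {D : Type*} [Ring D] [Algebra K D] (V : Submodule K D)
    [Module.Finite K V] (A : Type*) [AddCommMonoid A] [Module K A] :
    Function.Injective (dualTensorHom K V A) :=
  (dualTensorHomEquiv K V A).injective

theorem contraction_injective (n : ℕ) : Function.Injective (contraction R n) :=
  (dualTensorHom_submodule_injective (grading (orthogonal R) n) (QuadraticAlg R)).comp
    (TensorProduct.comm K _ _).injective

/-- This trades tensors for linear maps on `A^!_n`, where equality can be tested on words in the
`e_μ`. -/
theorem contraction_koszulDifferential (n : ℕ) (t : KoszulModule R (n + 1))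
    (v : DualComponent R n) : contraction R n (koszulDifferential R n t) v =
      ∑ μ, contraction R (n + 1) t (dualLeftMul R μ n v) * gen R μ := by
  rw [koszulDifferential, LinearMap.sum_apply, map_sum, LinearMap.sum_apply]
  refine Finset.sum_congr rfl fun μ _ => ?_
  induction t using TensorProduct.induction_on with
  | zero => simp
  | tmul a φ =>
    rw [TensorProduct.AlgebraTensorModule.map_tmul, contraction_tmul, contraction_tmul]
    simp
  | add s t hs ht => simp only [map_add, LinearMap.add_apply, hs, ht, add_mul]

theorem dualComponent_zero_hom_ext {V : Type*} [AddCommMonoid V] [Module K V]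
    {f g : DualComponent R 0 →ₗ[K] V} (h : f ⟨1, SetLike.one_mem_graded _⟩ =
      g ⟨1, SetLike.one_mem_graded _⟩) : f = g := by
  ext ⟨v, hv⟩
  have hv' := hv
  rw [grading, pow_zero] at hv'
  obtain ⟨r, rfl⟩ := Submodule.mem_one.1 hv'
  have : (⟨algebraMap K _ r, hv⟩ : DualComponent R 0) = r • ⟨1, SetLike.one_mem_graded _⟩ :=
    Subtype.ext (Algebra.algebraMap_eq_smul_one r)
  rw [this, map_smul, map_smul, h]

theorem dualComponent_succ_hom_ext {V : Type*} [AddCommMonoid V] [Module K V] {n : ℕ}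
    {f g : DualComponent R (n + 1) →ₗ[K] V}
    (h : ∀ μ v, f (dualLeftMul R μ n v) = g (dualLeftMul R μ n v)) : f = g := by
  have hle : grading (orthogonal R) (n + 1) ≤
      (LinearMap.eqLocus f g).map (grading (orthogonal R) (n + 1)).subtype := by
    conv_lhs => rw [grading, pow_succ']
    rw [Submodule.mul_le]
    intro m hm a ha
    induction hm using Submodule.span_induction with
    | mem m hm =>
      obtain ⟨μ, rfl⟩ := hm
      exact ⟨dualLeftMul R μ n ⟨a, ha⟩, h μ ⟨a, ha⟩, rfl⟩
    | zero => rw [zero_mul]; exact Submodule.zero_mem _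
    | add m m' _ _ hm hm' => rw [add_mul]; exact Submodule.add_mem _ hm hm'
    | smul r m _ hm => rw [smul_mul_assoc]; exact Submodule.smul_mem _ r hm
  ext v
  obtain ⟨w, hw, hwv⟩ := hle v.2
  rw [← Subtype.ext (a1 := w) (a2 := v) hwv]
  exact hw

theorem dualComponent_one_hom_ext {V : Type*} [AddCommMonoid V] [Module K V]
    {f g : DualComponent R 1 →ₗ[K] V}
    (h : ∀ ν, f (dualLeftMul R ν 0 ⟨1, SetLike.one_mem_graded _⟩) =
      g (dualLeftMul R ν 0 ⟨1, SetLike.one_mem_graded _⟩)) : f = g :=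
  dualComponent_succ_hom_ext R fun ν => LinearMap.congr_fun <|
    dualComponent_zero_hom_ext R (f := f ∘ₗ dualLeftMul R ν 0) (g := g ∘ₗ dualLeftMul R ν 0) (h ν)

theorem dualComponent_two_hom_ext {V : Type*} [AddCommMonoid V] [Module K V]
    {f g : DualComponent R 2 →ₗ[K] V}
    (h : ∀ μ ν, f (dualLeftMul R μ 1 (dualLeftMul R ν 0 ⟨1, SetLike.one_mem_graded _⟩)) =
      g (dualLeftMul R μ 1 (dualLeftMul R ν 0 ⟨1, SetLike.one_mem_graded _⟩))) : f = g :=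
  dualComponent_succ_hom_ext R fun μ => LinearMap.congr_fun <|
    dualComponent_one_hom_ext R (f := f ∘ₗ dualLeftMul R μ 1) (g := g ∘ₗ dualLeftMul R μ 1) (h μ)

end Contraction

section OneRelation

variable (B : Matrix ι ι K)

/-- The generators of the quadratic dual of a quadratic algebra with a single relation. -/
noncomputable abbrev dualGen (μ : ι) : Dual (Submodule.span K {B}) :=
  gen (orthogonal (Submodule.span K {B})) μ

theorem mem_orthogonal_span_singleton {B C : Matrix ι ι K} :
    C ∈ orthogonal (Submodule.span K {B}) ↔ ∑ μ, ∑ ν, B μ ν * C μ ν = 0 := by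
  constructor
  · exact fun h => h B (Submodule.mem_span_singleton_self B)
  · intro h B' hB'
    obtain ⟨r, rfl⟩ := Submodule.mem_span_singleton.1 hB'
    simp_rw [Matrix.smul_apply, smul_eq_mul, mul_assoc, ← Finset.mul_sum]
    rw [h, mul_zero]

/-- The action of the generator `e_μ` of the quadratic dual on `K ⊕ E^* ⊕ K`. -/
noncomputable def dualRep (μ : ι) : Module.End K (K × (ι → K) × K) :=
  open Classical in
  LinearMap.prod 0 (LinearMap.prod
    (LinearMap.single K (fun _ => K) μ ∘ₗ LinearMap.fst K K _)
    (Fintype.linearCombination K (B μ) ∘ₗ LinearMap.fst K _ K ∘ₗ LinearMap.snd K K _))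

/-- The linear form on the quadratic dual that maps `e_μ e_ν` to `B_{μν}`. -/
theorem exists_dual_form : ∃ φ : Dual (Submodule.span K {B}) →ₗ[K] K,
    ∀ μ ν, φ (dualGen B μ * dualGen B ν) = B μ ν := by
  classical
  have hmul (μ ν : ι) (z : K × (ι → K) × K) :
      (dualRep B μ * dualRep B ν) z = (0, 0, z.1 * B μ ν) := by
    simp [dualRep, Fintype.linearCombination_apply, Pi.single_apply]
  -- A product of two generators maps the first summand to the last by the factor `B_{μν}` and kills
  -- the rest, so elements of `R^⊥` act as zero.
  let ρ := lift (orthogonal (Submodule.span K {B})) (dualRep B) (fun C hC => by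
    rw [mem_orthogonal_span_singleton] at hC
    refine LinearMap.ext fun z => ?_
    simp only [LinearMap.sum_apply, LinearMap.smul_apply, hmul, LinearMap.zero_apply]
    refine Prod.ext ?_ (Prod.ext ?_ ?_)
    · simp [Prod.fst_sum]
    · simp [Prod.fst_sum, Prod.snd_sum]
    · simp only [Prod.snd_sum, Prod.smul_snd, smul_eq_mul, Prod.snd_zero]
      rw [← mul_zero z.1, ← hC, Finset.mul_sum]
      simp_rw [Finset.mul_sum]
      refine Finset.sum_congr rfl fun μ _ => Finset.sum_congr rfl fun ν _ => ?_
      ring)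
  refine ⟨LinearMap.snd K (ι → K) K ∘ₗ LinearMap.snd K K _ ∘ₗ
    LinearMap.applyₗ (1, 0, 0) ∘ₗ ρ.toLinearMap, fun μ ν => ?_⟩
  simp only [LinearMap.comp_apply, AlgHom.toLinearMap_apply, map_mul, LinearMap.applyₗ_apply_apply,
    ρ, lift_gen, hmul, LinearMap.snd_apply, one_mul]

variable {B}

/-- For `B_{αβ} ≠ 0`, the tensor `e_μ ⊗ e_ν - (B_{μν} / B_{αβ}) e_α ⊗ e_β` is orthogonal to `B`;
hence `ω = e_α e_β / B_{αβ}` works. -/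
theorem exists_dualGen_mul_dualGen_eq (hB : B ≠ 0) :
    ∃ ω ∈ grading (orthogonal (Submodule.span K {B})) 2,
      ∀ μ ν, dualGen B μ * dualGen B ν = B μ ν • ω := by
  classical
  obtain ⟨α, β, h⟩ : ∃ α β, B α β ≠ 0 := by
    by_contra! h
    exact hB (Matrix.ext h)
  refine ⟨(B α β)⁻¹ • (dualGen B α * dualGen B β), Submodule.smul_mem _ _
    (SetLike.mul_mem_graded (gen_mem _ α) (gen_mem _ β)), fun μ ν => ?_⟩
  have hC : Matrix.single μ ν 1 + Matrix.single α β (-((B α β)⁻¹ * B μ ν)) ∈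
      orthogonal (Submodule.span K {B}) := by
    rw [mem_orthogonal_span_singleton]
    simp only [Matrix.add_apply, mul_add, Finset.sum_add_distrib, Matrix.single_apply, ite_and,
      mul_ite, mul_zero, Finset.sum_ite_irrel, Finset.sum_const_zero, Finset.sum_ite_eq,
      Finset.mem_univ, if_true]
    rw [mul_neg, mul_inv_cancel_left₀ h, mul_one, add_neg_cancel]
  have h0 := sum_gen_mul_gen _ hC
  simp only [Matrix.add_apply, add_smul, Finset.sum_add_distrib, Matrix.single_apply, ite_and,
    ite_smul, zero_smul, Finset.sum_ite_irrel, Finset.sum_const_zero, Finset.sum_ite_eq,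
    Finset.mem_univ, if_true, one_smul] at h0
  calc dualGen B μ * dualGen B ν
      = dualGen B μ * dualGen B ν + (-((B α β)⁻¹ * B μ ν)) • (dualGen B α * dualGen B β) +
          ((B α β)⁻¹ * B μ ν) • (dualGen B α * dualGen B β) := by
        rw [add_assoc, ← add_smul, neg_add_cancel, zero_smul, add_zero]
    _ = B μ ν • (B α β)⁻¹ • (dualGen B α * dualGen B β) := by
        rw [h0, zero_add, smul_smul, mul_comm]

variable [DecidableEq ι] [Nontrivial ι] (hB : B.det ≠ 0)
include hB

/-- Associativity: choose `w ≠ 0` with `∑ B_{lμ} w_μ = 0`. Then `∑ w_μ e_l e_μ e_κ` is zero when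
bracketed on the left and `(wB)_κ e_l ω` when bracketed on the right, and some `(wB)_κ` is nonzero.
-/
theorem dualGen_mul_mul_eq_zero (l μ ν : ι) :
    dualGen B l * (dualGen B μ * dualGen B ν) = 0 := by
  obtain ⟨ω, -, hω⟩ := exists_dualGen_mul_dualGen_eq (B := B) (fun h => hB (by simp [h]))
  obtain ⟨w, hw, hwB⟩ := exists_ne_zero_sum_mul_eq_zero (B l)
  obtain ⟨κ, hκ⟩ : ∃ κ, Matrix.vecMul w B κ ≠ 0 := by
    by_contra! h
    exact hw (Matrix.eq_zero_of_vecMul_eq_zero hB (funext h))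
  have h1 : ∑ μ, w μ • (dualGen B l * (dualGen B μ * dualGen B κ)) =
      Matrix.vecMul w B κ • (dualGen B l * ω) := by
    simp_rw [hω, mul_smul_comm, smul_smul, ← Finset.sum_smul]
    rfl
  have h2 : ∑ μ, w μ • (dualGen B l * (dualGen B μ * dualGen B κ)) = 0 := by
    simp_rw [← mul_assoc, hω, smul_mul_assoc, smul_smul, ← Finset.sum_smul, hwB, zero_smul]
  rw [h2] at h1
  rw [hω, mul_smul_comm, (smul_eq_zero.1 h1.symm).resolve_left hκ, smul_zero]

theorem subsingleton_dualComponent (n : ℕ) :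
    Subsingleton (DualComponent (Submodule.span K {B}) (n + 3)) := by
  let R := Submodule.span K {B}
  have h₁ (l μ) : dualLeftMul R l (n + 2) ∘ₗ dualLeftMul R μ (n + 1) = 0 :=
    dualComponent_succ_hom_ext R fun ν v => by
      apply Subtype.ext
      change dualGen B l * (dualGen B μ * (dualGen B ν * v)) = 0
      rw [← mul_assoc (dualGen B μ), ← mul_assoc, dualGen_mul_mul_eq_zero hB, zero_mul]
  have h₂ (l) : dualLeftMul R l (n + 2) = 0 :=
    dualComponent_succ_hom_ext R fun μ v => LinearMap.congr_fun (h₁ l μ) v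
  have h₃ : (LinearMap.id : DualComponent R (n + 3) →ₗ[K] DualComponent R (n + 3)) = 0 :=
    dualComponent_succ_hom_ext R fun l v => LinearMap.congr_fun (h₂ l) v
  exact subsingleton_of_forall_eq 0 fun v => LinearMap.congr_fun h₃ v

/-- Contraction at `1`, at the `e_ν` and at `ω` turns the Koszul complex into `0 → A → A^{s+1} → A`,
whose exactness is already known. -/
theorem isKoszul_oneRel : IsKoszul (Submodule.span K {B}) := by
  set R := Submodule.span K {B} with hR
  obtain ⟨ω, hω2, hω⟩ := exists_dualGen_mul_dualGen_eq (B := B) (fun h => hB (by simp [h]))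
  let one₀ : DualComponent R 0 := ⟨1, SetLike.one_mem_graded _⟩
  have hsub (n : ℕ) : Subsingleton (KoszulModule R (n + 3)) :=
    have := subsingleton_dualComponent hB n
    (contraction_injective R (n + 3)).subsingleton
  have hmul2 (μ ν : ι) : dualLeftMul R μ 1 (dualLeftMul R ν 0 one₀) = B μ ν • ⟨ω, hω2⟩ := by
    apply Subtype.ext
    change dualGen B μ * (dualGen B ν * 1) = B μ ν • ω
    rw [mul_one, hω]
  have hd1 (t : KoszulModule R 2) (ν : ι) : contraction R 1 (koszulDifferential R 1 t)
      (dualLeftMul R ν 0 one₀) = contraction R 2 t ⟨ω, hω2⟩ * leftCoeff B ν := by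
    rw [contraction_koszulDifferential]
    simp only [hmul2, map_smul, leftCoeff, Finset.mul_sum, smul_mul_assoc, mul_smul_comm]
    rfl
  rintro (_ | _ | n) t
  · constructor
    · intro ht
      have h0 : ∑ μ, contraction R 1 t (dualLeftMul R μ 0 one₀) * oneRelGen B μ = 0 := by
        have := contraction_koszulDifferential R 0 t one₀
        rw [ht, map_zero, LinearMap.zero_apply] at this
        exact this.symm
      obtain ⟨d, hd⟩ := exists_eq_mul_leftCoeff h0
      -- A form with `φ ω = 1` makes `d ⊗ φ` contract to `d` at `ω`; its existence also shows `ω ≠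
      -- 0`.
      obtain ⟨φ, hφ⟩ := exists_dual_form B
      have hφω : φ ω = 1 := by
        obtain ⟨α, β, h⟩ : ∃ α β, B α β ≠ 0 := by
          by_contra! h
          exact hB (by rw [Matrix.ext (N := 0) h, Matrix.det_zero])
        have h' := hφ α β
        rw [hω, map_smul, smul_eq_mul] at h'
        exact mul_left_cancel₀ h (h'.trans (mul_one _).symm)
      refine ⟨d ⊗ₜ (φ ∘ₗ (grading (orthogonal R) 2).subtype), ?_⟩
      apply contraction_injective R 1
      refine dualComponent_one_hom_ext R fun ν => ?_
      change contraction R 1 (koszulDifferential R 1 _) (dualLeftMul R ν 0 one₀) =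
        contraction R 1 t (dualLeftMul R ν 0 one₀)
      rw [hd1, hd, contraction_tmul]
      simp [hφω]
    · rintro ⟨t, rfl⟩
      apply contraction_injective R 0
      apply dualComponent_zero_hom_ext R
      change contraction R 0 _ one₀ = _
      rw [contraction_koszulDifferential]
      simp only [hd1, mul_assoc, ← Finset.mul_sum]
      rw [map_zero, LinearMap.zero_apply]
      exact (congrArg _ (sum_leftCoeff_mul_gen B)).trans (mul_zero _)
  · have hsub0 := hsub 0
    constructor
    · intro ht
      refine ⟨0, ?_⟩
      rw [map_zero]
      symm
      have hω0 : contraction R 2 t ⟨ω, hω2⟩ = 0 := by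
        apply eq_zero_of_mul_leftCoeff_eq_zero hB (ν := Classical.arbitrary ι)
        have := hd1 t (Classical.arbitrary ι)
        rw [ht, map_zero, LinearMap.zero_apply] at this
        exact this.symm
      apply contraction_injective R 2
      rw [map_zero]
      refine dualComponent_two_hom_ext R fun μ ν => ?_
      change contraction R 2 t (dualLeftMul R μ 1 (dualLeftMul R ν 0 one₀)) = 0
      rw [hmul2, map_smul, hω0, smul_zero]
    · rintro ⟨s, rfl⟩
      rw [Subsingleton.elim s 0, map_zero, map_zero]
  · have := hsub n
    exact ⟨fun _ => ⟨0, Subsingleton.elim _ _⟩, fun _ => by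
      rw [Subsingleton.elim t 0, map_zero]⟩

end OneRelation

end QuadraticAlg

/-! ### Converse: the module of relations between the generators -/

section Converse

variable {K A : Type u} [Field K] [Ring A] [Algebra K A]
  {𝒜 : ℕ → Submodule K A} {ι : Type} {x : ι → A}

/-- Products of two elements of the square-zero ideal vanish, hence so does the image of every
relation of degree at least `2`. -/
theorem lift_trivSqZeroExt_eq_zero {K : Type u} [Field K] {ι : Type} [DecidableEq ι] {n : ℕ}
    (hn : 2 ≤ n) {r : FreeAlgebra K ι} (hr : r ∈ freeGrading K ι n) :
    FreeAlgebra.lift K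
      (fun μ : ι => (TrivSqZeroExt.inr (Pi.single μ 1) : TrivSqZeroExt K (ι → K))) r = 0 := by
  set f := FreeAlgebra.lift K
      (fun μ : ι => (TrivSqZeroExt.inr (Pi.single μ 1) : TrivSqZeroExt K (ι → K))) with hf
  obtain ⟨m, rfl⟩ := Nat.exists_eq_add_of_le' hn
  have hP : Submodule.map f.toLinearMap (Submodule.span K (Set.range (FreeAlgebra.ι K))) *
      Submodule.map f.toLinearMap (Submodule.span K (Set.range (FreeAlgebra.ι K))) = ⊥ := by
    rw [Submodule.map_span, Submodule.span_mul_span, eq_bot_iff, Submodule.span_le]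
    rintro _ ⟨_, ⟨_, ⟨μ, rfl⟩, rfl⟩, _, ⟨_, ⟨ν, rfl⟩, rfl⟩, rfl⟩
    simp [hf]
  have h : f r ∈ Submodule.map f.toLinearMap (freeGrading K ι (m + 2)) := ⟨r, hr, rfl⟩
  rw [freeGrading, Submodule.map_pow, pow_add, pow_two, hP, Submodule.mul_bot] at h
  exact h

/-- All relations die in the square-zero extension `K ⊕ K^ι`, while the generators go to a basis of
`K^ι`; a linear relation between the `x μ` would hold between basis vectors. -/
theorem IsGeneratedInDegreeOne.eq_zero_of_sum_smul_eq_zero [Fintype ι]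
    (hx : IsGeneratedInDegreeOne 𝒜 x) {c : ι → K} (hc : ∑ μ, c μ • x μ = 0) : c = 0 := by
  classical
  obtain ⟨S, hS, hker⟩ := hx.relations
  let f := FreeAlgebra.lift K
      (fun μ : ι => (TrivSqZeroExt.inr (Pi.single μ 1) : TrivSqZeroExt K (ι → K)))
  have hle : TwoSidedIdeal.span S ≤ TwoSidedIdeal.ker f := by
    rw [TwoSidedIdeal.span_le]
    intro r hr
    obtain ⟨n, hn, hrn⟩ := hS r hr
    exact (TwoSidedIdeal.mem_ker f).2 (lift_trivSqZeroExt_eq_zero hn hrn)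
  have h0 := (TwoSidedIdeal.mem_ker f).1 (hle ((hker (∑ μ, c μ • FreeAlgebra.ι K μ)).1 (by
    simpa using hc)))
  have h1 := congrArg TrivSqZeroExt.snd h0
  funext μ
  simpa [f, TrivSqZeroExt.snd_sum, Finset.sum_apply, Pi.single_apply] using congrFun h1 μ

variable [GradedAlgebra 𝒜]

variable (𝒜) in
/-- The component of degree `n` of a tuple of elements of a graded algebra. -/
def tupleComponent (n : ℕ) (z : ι → A) : ι → A := fun ν => DirectSum.decompose 𝒜 (z ν) n

theorem tupleComponent_add (n : ℕ) (z w : ι → A) :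
    tupleComponent 𝒜 n (z + w) = tupleComponent 𝒜 n z + tupleComponent 𝒜 n w := by
  funext ν; simp [tupleComponent]

theorem tupleComponent_smul_of_mem (n : ℕ) {i : ℕ} {a : A} (ha : a ∈ 𝒜 i) (z : ι → A) :
    tupleComponent 𝒜 n (a • z) = if i ≤ n then a • tupleComponent 𝒜 (n - i) z else 0 := by
  funext ν
  simp only [tupleComponent, Pi.smul_apply, smul_eq_mul]
  rw [DirectSum.coe_decompose_mul_of_left_mem 𝒜 n ha]
  split_ifs <;> rfl

theorem tupleComponent_self (n : ℕ) (z : ι → A) :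
    tupleComponent 𝒜 n (tupleComponent 𝒜 n z) = tupleComponent 𝒜 n z := by
  funext ν; simp [tupleComponent]

theorem tupleComponent_of_ne {n m : ℕ} (h : n ≠ m) (z : ι → A) :
    tupleComponent 𝒜 m (tupleComponent 𝒜 n z) = 0 := by
  funext ν
  exact DirectSum.decompose_of_mem_ne 𝒜 (SetLike.coe_mem _) h

theorem exists_sum_tupleComponent_eq [Fintype ι] (z : ι → A) :
    ∃ N, ∑ n ∈ Finset.range N, tupleComponent 𝒜 n z = z := by
  classical
  obtain ⟨N, hN⟩ := (Finset.univ.biUnion fun ν =>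
    DFinsupp.support (DirectSum.decompose 𝒜 (z ν))).exists_nat_subset_range
  refine ⟨N, funext fun ν => ?_⟩
  rw [Finset.sum_apply]
  conv_rhs => rw [← DirectSum.sum_support_decompose 𝒜 (z ν)]
  symm
  refine Finset.sum_subset (fun i hi => hN (Finset.mem_biUnion.2 ⟨ν, Finset.mem_univ _, hi⟩))
    fun i _ hi => ?_
  rw [DFinsupp.notMem_support_iff] at hi
  rw [hi, ZeroMemClass.coe_zero]

variable [Fintype ι]

variable (x) in
/-- The left module of the relations between the elements `x μ`. -/
noncomputable def syzygies : Submodule A (ι → A) := LinearMap.ker (Fintype.linearCombination A x)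

theorem mem_syzygies {z : ι → A} : z ∈ syzygies x ↔ ∑ ν, z ν * x ν = 0 := by
  simp [syzygies, Fintype.linearCombination_apply]

theorem decompose_sum_mul (hx1 : ∀ μ, x μ ∈ 𝒜 1) (z : ι → A) (n : ℕ) :
    (DirectSum.decompose 𝒜 (∑ ν, z ν * x ν) (n + 1) : A) =
      ∑ ν, tupleComponent 𝒜 n z ν * x ν := by
  rw [DirectSum.decompose_sum, DFinsupp.finsetSum_apply, AddSubmonoidClass.coe_finsetSum]
  exact Finset.sum_congr rfl fun ν _ => decompose_mul_of_mem 𝒜 (hx1 ν) (z ν) n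

theorem tupleComponent_mem_syzygies (hx1 : ∀ μ, x μ ∈ 𝒜 1) {z : ι → A} (hz : z ∈ syzygies x)
    (n : ℕ) : tupleComponent 𝒜 n z ∈ syzygies x := by
  rw [mem_syzygies] at hz ⊢
  rw [← decompose_sum_mul hx1, hz]
  simp

variable [IsConnectedGraded 𝒜]

/-- Minimality of the resolution: the degree `0` parts of the entries give a linear relation between
the generators. -/
theorem augmentation_of_mem_syzygies (hx : IsGeneratedInDegreeOne 𝒜 x) {z : ι → A}
    (hz : z ∈ syzygies x) (ν : ι) : augmentation 𝒜 (z ν) = 0 := by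
  have h := mem_syzygies.1 (tupleComponent_mem_syzygies hx.degree_one hz 0)
  simp only [tupleComponent, ← algebraMap_augmentation_eq_decompose, ← Algebra.smul_def] at h
  exact congrFun (hx.eq_zero_of_sum_smul_eq_zero h) ν

/-- A graded form of Nakayama's lemma: if the module of relations is generated modulo its product
with the augmentation ideal by a homogeneous element, it is generated by that element. -/
theorem syzygies_le_span_of_homogeneous {d : ℕ} {v : ι → A}
    (hv : tupleComponent 𝒜 d v = v)
    (h : ∀ z ∈ syzygies x, ∃ r : K, z - algebraMap K A r • v ∈ AddSubgroup.closure
      {w | ∃ a z', augmentation 𝒜 a = 0 ∧ z' ∈ syzygies x ∧ w = a • z'}) :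
    syzygies x ≤ Submodule.span A {v} := by
  classical
  have key (n : ℕ) : ∀ z ∈ syzygies x, tupleComponent 𝒜 n z ∈ Submodule.span A {v} := by
    induction n using Nat.strong_induction_on with
    | _ n ih =>
    have hw (w) (hw : w ∈ AddSubgroup.closure
        {w | ∃ a z', augmentation 𝒜 a = 0 ∧ z' ∈ syzygies x ∧ w = a • z'}) :
        tupleComponent 𝒜 n w ∈ Submodule.span A {v} := by
      induction hw using AddSubgroup.closure_induction with
      | mem w hw =>
        obtain ⟨a, z, ha, hz, rfl⟩ := hw
        have hsum : ∀ s : Finset ℕ, tupleComponent 𝒜 n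
            ((∑ i ∈ s, (DirectSum.decompose 𝒜 a i : A)) • z) ∈ Submodule.span A {v} := by
          intro s
          induction s using Finset.induction_on with
          | empty =>
            have : tupleComponent 𝒜 n ((0 : A) • z) = 0 := by
              funext ν; simp [tupleComponent]
            rw [Finset.sum_empty, this]
            exact Submodule.zero_mem _
          | insert i s hi hs =>
            rw [Finset.sum_insert hi, add_smul, tupleComponent_add]
            refine Submodule.add_mem _ ?_ hs
            rw [tupleComponent_smul_of_mem n (SetLike.coe_mem _)]
            split_ifs with hin
            -- The component `a_0` is `ε a = 0`, and a component of positive degree only meets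
            -- components of `z` of degree below `n`.
            · rcases Nat.eq_zero_or_pos i with rfl | hi0
              · rw [← algebraMap_augmentation_eq_decompose, ha, map_zero, zero_smul]
                exact Submodule.zero_mem _
              · exact Submodule.smul_mem _ _ (ih _ (by omega) z hz)
            · exact Submodule.zero_mem _
        have := hsum (DFinsupp.support (DirectSum.decompose 𝒜 a))
        rwa [DirectSum.sum_support_decompose] at this
      | zero =>
        have : tupleComponent 𝒜 n (0 : ι → A) = 0 := by funext ν; simp [tupleComponent]
        rw [this]
        exact Submodule.zero_mem _
      | add w w' _ _ hw hw' => rw [tupleComponent_add]; exact Submodule.add_mem _ hw hw'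
      | neg w _ hw =>
        have : tupleComponent 𝒜 n (-w) = -tupleComponent 𝒜 n w := by
          funext ν
          simp only [tupleComponent, Pi.neg_apply, DirectSum.decompose_neg]
          rfl
        rw [this]
        exact Submodule.neg_mem _ hw
    intro z hz
    obtain ⟨r, hr⟩ := h z hz
    have hz' : z = (z - algebraMap K A r • v) + algebraMap K A r • v := by abel
    rw [hz', tupleComponent_add]
    refine Submodule.add_mem _ (hw _ hr) ?_
    rw [tupleComponent_smul_of_mem n (SetLike.algebraMap_mem_graded 𝒜 r)]
    split_ifs
    · refine Submodule.smul_mem _ _ ?_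
      rw [Nat.sub_zero, ← hv]
      by_cases hdn : d = n
      · rw [← hdn, tupleComponent_self, hv]
        exact Submodule.mem_span_singleton_self v
      · rw [tupleComponent_of_ne hdn]
        exact Submodule.zero_mem _
    · exact Submodule.zero_mem _
  intro z hz
  obtain ⟨N, hN⟩ := exists_sum_tupleComponent_eq (𝒜 := 𝒜) z
  rw [← hN]
  exact Submodule.sum_mem _ fun n _ => key n z hz

open Abelian

/-- The Yoneda description of `Ext²(K, A)` by the linear forms on the module of relations. -/
theorem exists_hom_syzygies_to_ext_two (hx : IsGeneratedInDegreeOne 𝒜 x) :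
    ∃ θ : (syzygies x →ₗ[A] A) →+ Ext (trivialModule 𝒜) (ModuleCat.of A A) 2,
      Function.Surjective θ ∧
      (∀ f, θ f = 0 ↔ ∃ c : ι → A, ∀ z : syzygies x, f z = ∑ ν, (z : ι → A) ν * c ν) ∧
      ∀ f a, extRightAction (θ f) a = θ (LinearMap.toSpanSingleton A A a ∘ₗ f) := by
  classical
  have hq := shortExact_of_injective_of_exact (f₁ := Fintype.linearCombination A x)
    (syzygies x).injective_subtype (LinearMap.exact_subtype_ker_map _)
  have hp := shortExact_of_exact_of_surjective
    (exact_linearCombination_augmentationHom 𝒜 hx.degree_one hx.generates)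
    (augmentationHom_surjective 𝒜)
  have P₁ : Projective (ModuleCat.of A (ι → A)) := ModuleCat.projective_of_free (Pi.basisFun A ι)
  have P₀ : Projective (ModuleCat.of A A) :=
    ModuleCat.projective_of_free (Module.Basis.singleton Unit A)
  refine ⟨(spliceExt hq hp (ModuleCat.of A A)).comp (ModuleCat.homAddEquiv
    (M := ModuleCat.of A (syzygies x)) (N := ModuleCat.of A A)).symm.toAddMonoidHom,
    fun α => ?_, fun f => ?_, fun f a => spliceExt_comp hq hp _ _⟩
  · obtain ⟨f, rfl⟩ := spliceExt_surjective hq hp _ α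
    exact ⟨f.hom, rfl⟩
  · refine (spliceExt_eq_zero_iff hq hp (ModuleCat.ofHom f)).trans ⟨?_, ?_⟩
    · rintro ⟨g, hg⟩
      refine ⟨fun ν => g.hom (Pi.single ν 1), fun z => ?_⟩
      rw [← show g.hom (z : ι → A) = f z from
        LinearMap.congr_fun (congrArg ModuleCat.Hom.hom hg) z]
      conv_lhs => rw [pi_eq_sum_univ' (z : ι → A)]
      simp [map_sum]
    · rintro ⟨c, hc⟩
      refine ⟨ModuleCat.ofHom (Fintype.linearCombination A c),
        ModuleCat.hom_ext (LinearMap.ext fun z => ?_)⟩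
      exact (Fintype.linearCombination_apply A c _).trans (hc z).symm

theorem projective_syzygies (hx : IsGeneratedInDegreeOne 𝒜 x)
    [HasProjectiveDimensionLE (trivialModule 𝒜) 2] : Module.Projective A (syzygies x) := by
  classical
  have hq := shortExact_of_injective_of_exact (f₁ := Fintype.linearCombination A x)
    (syzygies x).injective_subtype (LinearMap.exact_subtype_ker_map _)
  have hp := shortExact_of_exact_of_surjective
    (exact_linearCombination_augmentationHom 𝒜 hx.degree_one hx.generates)
    (augmentationHom_surjective 𝒜)
  have P₁ : Projective (ModuleCat.of A (ι → A)) := ModuleCat.projective_of_free (Pi.basisFun A ι)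
  have P₀ : Projective (ModuleCat.of A A) :=
    ModuleCat.projective_of_free (Module.Basis.singleton Unit A)
  exact (IsProjective.iff_projective (syzygies x)).2
    (projective_of_hasProjectiveDimensionLE_two hq hp)

/-- In a connected graded algebra of global dimension `2` with `Ext²(K, A)` the trivial module,
the relations between the generators are the multiples of a single homogeneous one, and this
relation generates `A_+` modulo the choice of a linear form. -/
theorem exists_generator_syzygies (hx : IsGeneratedInDegreeOne 𝒜 x)
    [HasProjectiveDimensionLE (trivialModule 𝒜) 2]
    (e : Ext (trivialModule 𝒜) (ModuleCat.of A A) 2 ≃+ K)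
    (he : ∀ α a, e (extRightAction α a) = e α * augmentation 𝒜 a) :
    ∃ (d : ℕ) (v : ι → A), v ∈ syzygies x ∧ (∀ ν, v ν ∈ 𝒜 d) ∧
      syzygies x ≤ Submodule.span A {v} ∧
      ∃ u : A, augmentation 𝒜 u ≠ 0 ∧
        ∀ a, augmentation 𝒜 a = 0 → ∃ c : ι → A, u * a = ∑ ν, v ν * c ν := by
  obtain ⟨θ, hθ, hker, hact⟩ := exists_hom_syzygies_to_ext_two hx
  have hproj := projective_syzygies hx
  -- The coordinates of the section `s` are linear forms that act as a dual basis.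
  obtain ⟨s, hs⟩ := Module.projective_def'.1 hproj
  have hkeraug (f) (hf : θ f = 0) (z : syzygies x) : augmentation 𝒜 (f z) = 0 := by
    obtain ⟨c, hc⟩ := (hker f).1 hf
    simp [hc, augmentation_of_mem_syzygies hx z.2]
  set W := AddSubgroup.closure
      {w | ∃ a z', augmentation 𝒜 a = 0 ∧ z' ∈ syzygies x ∧ w = a • z'} with hW
  have hdual (z : syzygies x) (h : ∀ i, augmentation 𝒜 (s z i) = 0) : (z : ι → A) ∈ W := by
    have hz : (Finsupp.linearCombination A id) (s z) = z := LinearMap.congr_fun hs z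
    rw [← hz, Finsupp.linearCombination_apply, Finsupp.sum, AddSubmonoidClass.coe_finsetSum]
    exact AddSubgroup.sum_mem _ fun i _ => AddSubgroup.subset_closure ⟨s z i, i, h i, i.2, rfl⟩
  -- Otherwise the dual basis gives `S = A_+ S`, hence `S = 0` by Nakayama, and `Ext²` would vanish.
  obtain ⟨f₀, z₁, hf₀⟩ : ∃ (f₀ : syzygies x →ₗ[A] A) (z : syzygies x),
      augmentation 𝒜 (f₀ z) ≠ 0 := by
    by_contra! hall
    have hzero : syzygies x ≤ Submodule.span A {0} := by
      refine syzygies_le_span_of_homogeneous (𝒜 := 𝒜) (d := 0)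
        (by funext ν; simp [tupleComponent]) fun z hz => ⟨0, ?_⟩
      rw [smul_zero, sub_zero]
      exact hdual ⟨z, hz⟩ fun i => hall (Finsupp.lapply i ∘ₗ s) ⟨z, hz⟩
    have hsub : ∀ f : syzygies x →ₗ[A] A, f = 0 := fun f => LinearMap.ext fun z => by
      have hz : z = 0 := by
        have := hzero z.2
        rw [Submodule.mem_span_singleton] at this
        obtain ⟨a, ha⟩ := this
        exact Subtype.ext (by rw [← ha, smul_zero]; rfl)
      rw [hz, map_zero, map_zero]
    obtain ⟨f, hf⟩ := hθ (e.symm 1)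
    rw [hsub f, map_zero] at hf
    have := congrArg e hf
    rw [map_zero, AddEquiv.apply_symm_apply] at this
    exact zero_ne_one this
  set k₀ := e (θ f₀) with hk₀
  have hk₀ne : k₀ ≠ 0 := fun h => hf₀ (hkeraug f₀ (e.injective (h.trans (map_zero e).symm)) z₁)
  -- Every class is a scalar multiple of that of `f₀`, and forms with the same class agree modulo
  -- `A_+`. So `ε ∘ f₀` alone detects `S/A_+S`.
  have hsplit (f : syzygies x →ₗ[A] A) (z : syzygies x) :
      augmentation 𝒜 (f z) = augmentation 𝒜 (f₀ z) * (k₀⁻¹ * e (θ f)) := by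
    have h0 : θ (f - LinearMap.toSpanSingleton A A (algebraMap K A (k₀⁻¹ * e (θ f))) ∘ₗ f₀) =
        0 := by
      apply e.injective
      rw [map_sub, ← hact, map_sub, he, augmentation_algebraMap, ← hk₀,
        mul_inv_cancel_left₀ hk₀ne, sub_self, map_zero]
    have h1 := hkeraug _ h0 z
    rw [LinearMap.sub_apply, map_sub, sub_eq_zero] at h1
    rw [h1, LinearMap.comp_apply, LinearMap.toSpanSingleton_apply, smul_eq_mul, map_mul,
      augmentation_algebraMap]
  obtain ⟨d, hd⟩ : ∃ d, augmentation 𝒜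
      (f₀ ⟨tupleComponent 𝒜 d z₁, tupleComponent_mem_syzygies hx.degree_one z₁.2 d⟩) ≠ 0 := by
    by_contra! hall
    obtain ⟨N, hN⟩ := exists_sum_tupleComponent_eq (𝒜 := 𝒜) (z₁ : ι → A)
    have : z₁ = ∑ n ∈ Finset.range N,
        ⟨tupleComponent 𝒜 n z₁, tupleComponent_mem_syzygies hx.degree_one z₁.2 n⟩ := by
      apply Subtype.ext
      rw [AddSubmonoidClass.coe_finsetSum]
      exact hN.symm
    rw [this, map_sum, map_sum] at hf₀
    exact hf₀ (Finset.sum_eq_zero fun n _ => hall n)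
  set v : syzygies x := ⟨tupleComponent 𝒜 d z₁, tupleComponent_mem_syzygies hx.degree_one z₁.2 d⟩
  refine ⟨d, v, v.2, fun ν => SetLike.coe_mem _, ?_, f₀ v, hd, fun a ha => ?_⟩
  · refine syzygies_le_span_of_homogeneous (𝒜 := 𝒜) (d := d)
      (tupleComponent_self d _) fun z hz =>
        ⟨augmentation 𝒜 (f₀ ⟨z, hz⟩) / augmentation 𝒜 (f₀ v), ?_⟩
    refine hdual (⟨z, hz⟩ - algebraMap K A
      (augmentation 𝒜 (f₀ ⟨z, hz⟩) / augmentation 𝒜 (f₀ v)) • v) fun i => ?_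
    have h0 : augmentation 𝒜 (f₀ (⟨z, hz⟩ - algebraMap K A
        (augmentation 𝒜 (f₀ ⟨z, hz⟩) / augmentation 𝒜 (f₀ v)) • v)) = 0 := by
      rw [map_sub, map_smul, smul_eq_mul, map_sub, map_mul, augmentation_algebraMap,
        div_mul_cancel₀ _ hd, sub_self]
    have := hsplit (Finsupp.lapply i ∘ₗ s) (⟨z, hz⟩ - algebraMap K A
      (augmentation 𝒜 (f₀ ⟨z, hz⟩) / augmentation 𝒜 (f₀ v)) • v)
    rw [h0, zero_mul] at this
    exact this
  -- The right action of `A_+` on `Ext²` is zero, so `z ↦ f₀(z) a` extends to `A^ι`; evaluate it at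
  -- `v`, with `u = f₀ v`.
  · have h0 : θ (LinearMap.toSpanSingleton A A a ∘ₗ f₀) = 0 := by
      apply e.injective
      rw [← hact, he, ha, mul_zero, map_zero]
    obtain ⟨c, hc⟩ := (hker _).1 h0
    exact ⟨c, hc v⟩

theorem IsGeneratedInDegreeOne.exists_eq_sum_smul (hx : IsGeneratedInDegreeOne 𝒜 x) {a : A}
    (ha : a ∈ 𝒜 1) : ∃ c : ι → K, a = ∑ μ, c μ • x μ := by
  obtain ⟨c, hc⟩ := exists_eq_sum_of_augmentation_eq_zero 𝒜 hx.degree_one hx.generates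
    (augmentation_of_mem 𝒜 one_ne_zero ha)
  refine ⟨fun μ => augmentation 𝒜 (c μ), ?_⟩
  have h := decompose_sum_mul hx.degree_one c 0
  rw [← hc, zero_add, DirectSum.decompose_of_mem_same 𝒜 ha] at h
  rw [h]
  simp [tupleComponent, ← algebraMap_augmentation_eq_decompose, Algebra.smul_def]

/-- Compare parts of degree `1` in `u x^l = ∑ v_ν c_ν`. The left side gives `ε(u) x^l ≠ 0`, so `d ≤
1`; the case `d = 0` would make `v` vanish by minimality. Hence the `v_ν` are linear forms spanning
the generators. -/
theorem exists_matrix_syzygies [DecidableEq ι] [Nonempty ι] (hx : IsGeneratedInDegreeOne 𝒜 x)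
    [HasProjectiveDimensionLE (trivialModule 𝒜) 2]
    (e : Ext (trivialModule 𝒜) (ModuleCat.of A A) 2 ≃+ K)
    (he : ∀ α a, e (extRightAction α a) = e α * augmentation 𝒜 a) :
    ∃ B : Matrix ι ι K, B.det ≠ 0 ∧ ∑ ν, (∑ μ, B μ ν • x μ) * x ν = 0 ∧
      ∀ a : ι → A, ∑ ν, a ν * x ν = 0 → ∃ d, ∀ ν, a ν = d * ∑ μ, B μ ν • x μ := by
  obtain ⟨d, v, hv, hvd, hspan, u, hu, hsurj⟩ := exists_generator_syzygies hx e he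
  have hxne (l : ι) : x l ≠ 0 := fun h => by
    have := congrFun (hx.eq_zero_of_sum_smul_eq_zero (c := Pi.single l 1) (by
      simp [Pi.single_apply, h])) l
    simp at this
  have hd0 : d ≠ 0 := by
    rintro rfl
    have hv0 : ∀ ν, v ν = 0 := fun ν => by
      rw [eq_algebraMap_of_mem_zero 𝒜 (hvd ν), augmentation_of_mem_syzygies hx hv, map_zero]
    obtain ⟨c, hc⟩ := hsurj (x (Classical.arbitrary ι))
      (augmentation_of_mem 𝒜 one_ne_zero (hx.degree_one _))
    simp only [hv0, zero_mul, Finset.sum_const_zero] at hc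
    have := decompose_mul_of_mem 𝒜 (hx.degree_one (Classical.arbitrary ι)) u 0
    rw [hc, ← algebraMap_augmentation_eq_decompose, ← Algebra.smul_def] at this
    simp only [DirectSum.decompose_zero, DirectSum.zero_apply, ZeroMemClass.coe_zero] at this
    exact (smul_ne_zero hu (hxne _)) this.symm
  have hcomp (l : ι) : ∃ c : ι → A, augmentation 𝒜 u • x l =
      ∑ ν, if d ≤ 1 then v ν * DirectSum.decompose 𝒜 (c ν) (1 - d) else 0 := by
    obtain ⟨c, hc⟩ := hsurj (x l) (augmentation_of_mem 𝒜 one_ne_zero (hx.degree_one _))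
    refine ⟨c, ?_⟩
    have := decompose_mul_of_mem 𝒜 (hx.degree_one l) u 0
    rw [hc, ← algebraMap_augmentation_eq_decompose, ← Algebra.smul_def, DirectSum.decompose_sum,
      DFinsupp.finsetSum_apply, AddSubmonoidClass.coe_finsetSum] at this
    rw [← this]
    exact Finset.sum_congr rfl fun ν _ =>
      DirectSum.coe_decompose_mul_of_left_mem 𝒜 (0 + 1) (hvd ν)
  obtain rfl : d = 1 := by
    by_contra hd1
    obtain ⟨c, hc⟩ := hcomp (Classical.arbitrary ι)
    simp only [show ¬ d ≤ 1 by omega, if_false, Finset.sum_const_zero] at hc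
    exact smul_ne_zero hu (hxne _) hc
  choose b hb using fun ν => hx.exists_eq_sum_smul (hvd ν)
  have hinv (l : ι) : ∃ t : ι → K, x l = ∑ ν, t ν • v ν := by
    obtain ⟨c, hc⟩ := hcomp l
    refine ⟨fun ν => (augmentation 𝒜 u)⁻¹ * augmentation 𝒜 (c ν), ?_⟩
    rw [eq_comm, ← inv_smul_eq_iff₀ hu] at hc
    rw [← hc, Finset.smul_sum]
    refine Finset.sum_congr rfl fun ν _ => ?_
    rw [if_pos le_rfl, Nat.sub_self, ← algebraMap_augmentation_eq_decompose, mul_smul,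
      ← Algebra.commutes, ← Algebra.smul_def]
  choose t ht using hinv
  let B : Matrix ι ι K := Matrix.of fun μ ν => b ν μ
  let T : Matrix ι ι K := Matrix.of fun ν l => t l ν
  -- Substitute `v_ν = ∑ B_{μν} x^μ` into `x^l = ∑ T_{νl} v_ν` and use the independence of the
  -- generators.
  have hBT : B * T = 1 := by
    ext μ l
    have h : ∑ μ, ((B * T) μ l - (1 : Matrix ι ι K) μ l) • x μ = 0 := by
      simp only [sub_smul, Finset.sum_sub_distrib, Matrix.mul_apply, Finset.sum_smul,
        Matrix.one_apply, ite_smul, zero_smul, one_smul, Finset.sum_ite_eq', Finset.mem_univ,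
        if_true]
      rw [sub_eq_zero, Finset.sum_comm]
      conv_rhs => rw [ht l]
      refine Finset.sum_congr rfl fun ν _ => ?_
      rw [hb ν, Finset.smul_sum]
      refine Finset.sum_congr rfl fun μ _ => ?_
      rw [smul_smul, mul_comm]
      rfl
    exact sub_eq_zero.1 (congrFun (hx.eq_zero_of_sum_smul_eq_zero h) μ)
  have hBv (ν : ι) : ∑ μ, B μ ν • x μ = v ν := (hb ν).symm
  refine ⟨B, fun h => ?_, ?_, fun a ha => ?_⟩
  · have := congrArg Matrix.det hBT
    rw [Matrix.det_mul, h, zero_mul, Matrix.det_one] at this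
    exact zero_ne_one this
  · simpa only [hBv] using mem_syzygies.1 hv
  · obtain ⟨c, hc⟩ := Submodule.mem_span_singleton.1 (hspan (mem_syzygies.2 ha))
    exact ⟨c, fun ν => by rw [hBv, ← hc]; rfl⟩

end Converse

/-! ### The isomorphism with the algebra of the bilinear form -/

section Isomorphism

open QuadraticAlg

variable {K A : Type u} [Field K] [Ring A] [Algebra K A] {𝒜 : ℕ → Submodule K A}
  {ι : Type} [Fintype ι] {x : ι → A}

theorem QuadraticAlg.grading_map_le [GradedAlgebra 𝒜] (R : Submodule K (Matrix ι ι K))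
    (hx1 : ∀ μ, x μ ∈ 𝒜 1) (φ : QuadraticAlg R →ₐ[K] A) (hφ : ∀ μ, φ (gen R μ) = x μ) (n : ℕ) :
    (grading R n).map φ.toLinearMap ≤ 𝒜 n := by
  rw [grading, Submodule.map_pow]
  have h : Submodule.map φ.toLinearMap (Submodule.span K (Set.range (gen R))) ≤ 𝒜 1 := by
    rw [Submodule.map_span, Submodule.span_le]
    rintro _ ⟨_, ⟨μ, rfl⟩, rfl⟩
    exact (hφ μ).symm ▸ hx1 μ
  induction n with
  | zero => rw [pow_zero, Submodule.one_le]; exact SetLike.one_mem_graded 𝒜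
  | succ n ih =>
    rw [pow_succ, Submodule.mul_le]
    exact fun a ha c hc => SetLike.mul_mem_graded (ih ha) (h hc)

theorem QuadraticAlg.map_decompose [GradedAlgebra 𝒜] (R : Submodule K (Matrix ι ι K))
    (hx1 : ∀ μ, x μ ∈ 𝒜 1) (φ : QuadraticAlg R →ₐ[K] A) (hφ : ∀ μ, φ (gen R μ) = x μ)
    (a : QuadraticAlg R) (n : ℕ) :
    φ (DirectSum.decompose (grading R) a n) = DirectSum.decompose 𝒜 (φ a) n := by
  classical
  conv_rhs => rw [← DirectSum.sum_support_decompose (grading R) a]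
  have hmem (i : ℕ) : φ (DirectSum.decompose (grading R) a i) ∈ 𝒜 i :=
    grading_map_le R hx1 φ hφ i ⟨_, SetLike.coe_mem _, rfl⟩
  rw [map_sum, DirectSum.decompose_sum, DFinsupp.finsetSum_apply,
    AddSubmonoidClass.coe_finsetSum, Finset.sum_eq_single n]
  · rw [DirectSum.decompose_of_mem_same 𝒜 (hmem n)]
  · exact fun i _ hi => DirectSum.decompose_of_mem_ne 𝒜 (hmem i) hi
  · intro hn
    rw [DFinsupp.notMem_support_iff.1 hn]
    simp

theorem QuadraticAlg.surjective_of_generates (R : Submodule K (Matrix ι ι K))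
    (hx : Algebra.adjoin K (Set.range x) = ⊤) (φ : QuadraticAlg R →ₐ[K] A)
    (hφ : ∀ μ, φ (gen R μ) = x μ) : Function.Surjective φ := by
  rw [← AlgHom.range_eq_top, eq_top_iff, ← hx, Algebra.adjoin_le_iff]
  rintro _ ⟨μ, rfl⟩
  exact ⟨_, hφ μ⟩

variable [GradedAlgebra 𝒜] [IsConnectedGraded 𝒜]

/-- Write a kernel element of degree `n + 1` as `∑ c_ν x^ν`. Exactness in `A` gives `φ(c_ν) = φ(d)
v_ν`, where `v_ν` is formed in `A`; by induction `c_ν` is then the degree `n` part of `d` times the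
corresponding linear form, and the sum is zero by the defining relation. -/
theorem QuadraticAlg.injective_of_exact (hx1 : ∀ μ, x μ ∈ 𝒜 1)
    (hx : Algebra.adjoin K (Set.range x) = ⊤) {B : Matrix ι ι K}
    (hexact : ∀ a : ι → A, ∑ ν, a ν * x ν = 0 → ∃ d, ∀ ν, a ν = d * ∑ μ, B μ ν • x μ)
    (φ : OneRel B →ₐ[K] A) (hφ : ∀ μ, φ (oneRelGen B μ) = x μ) : Function.Injective φ := by
  let G := grading (Submodule.span K {B})
  have hhom (n : ℕ) : ∀ a ∈ G n, φ a = 0 → a = 0 := by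
    induction n with
    | zero =>
      intro a ha h
      rw [eq_algebraMap_of_mem_zero G ha, AlgHom.commutes] at h
      rw [eq_algebraMap_of_mem_zero G ha,
        algebraMap_injective_of_isConnectedGraded 𝒜 (h.trans (map_zero _).symm), map_zero]
    | succ n ih =>
      intro a ha h
      obtain ⟨c, hc⟩ := exists_eq_sum_of_augmentation_eq_zero G (gen_mem _) (adjoin_range_gen _)
        (augmentation_of_mem G n.succ_ne_zero ha)
      have hcomp (b : ι → OneRel B) :
          (DirectSum.decompose G (∑ ν, b ν * oneRelGen B ν) (n + 1) : OneRel B) =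
            ∑ ν, (DirectSum.decompose G (b ν) n : OneRel B) * oneRelGen B ν :=
        decompose_sum_mul (gen_mem _) b n
      have hac : a = ∑ ν, (DirectSum.decompose G (c ν) n : OneRel B) * oneRelGen B ν := by
        rw [← hcomp, ← hc, DirectSum.decompose_of_mem_same G ha]
      have h0 : ∑ ν, φ (DirectSum.decompose G (c ν) n) * x ν = 0 := by
        rw [← h, hac, map_sum]
        simp [hφ]
      obtain ⟨d, hd⟩ := hexact _ h0
      obtain ⟨d, rfl⟩ := surjective_of_generates _ hx φ hφ d
      have hcd (ν : ι) : (DirectSum.decompose G (c ν) n : OneRel B) =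
          DirectSum.decompose G (d * leftCoeff B ν) n := by
        rw [← sub_eq_zero]
        refine ih _ (Submodule.sub_mem _ (SetLike.coe_mem _) (SetLike.coe_mem _)) ?_
        rw [map_sub, map_decompose _ hx1 φ hφ (d * leftCoeff B ν), map_mul]
        have hy : φ (leftCoeff B ν) = ∑ μ, B μ ν • x μ := by simp [leftCoeff, hφ]
        rw [hy, ← hd, DirectSum.decompose_of_mem_same 𝒜, sub_self]
        exact grading_map_le _ hx1 φ hφ n ⟨_, SetLike.coe_mem _, rfl⟩
      rw [hac]
      simp_rw [hcd]
      rw [← hcomp]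
      simp_rw [mul_assoc]
      rw [← Finset.mul_sum, sum_leftCoeff_mul_gen, mul_zero]
      simp
  rw [injective_iff_map_eq_zero]
  intro a ha
  apply (DirectSum.decompose G).injective
  ext n
  rw [DirectSum.decompose_zero]
  refine hhom n _ (SetLike.coe_mem _) ?_
  rw [map_decompose _ hx1 φ hφ, ha]
  simp

theorem QuadraticAlg.exists_algEquiv_oneRel (hx1 : ∀ μ, x μ ∈ 𝒜 1)
    (hx : Algebra.adjoin K (Set.range x) = ⊤) {B : Matrix ι ι K}
    (hrel : ∑ ν, (∑ μ, B μ ν • x μ) * x ν = 0)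
    (hexact : ∀ a : ι → A, ∑ ν, a ν * x ν = 0 → ∃ d, ∀ ν, a ν = d * ∑ μ, B μ ν • x μ) :
    ∃ e : OneRel B ≃ₐ[K] A, (∀ μ, e (oneRelGen B μ) = x μ) ∧
      ∀ n, (grading (Submodule.span K {B}) n).map e.toLinearMap = 𝒜 n := by
  have hrel' : ∑ μ, ∑ ν, B μ ν • (x μ * x ν) = 0 := by
    rw [← hrel, Finset.sum_comm]
    simp [Finset.sum_mul]
  let φ : OneRel B →ₐ[K] A := oneRelLift x hrel'
  have hφ : ∀ μ, φ (oneRelGen B μ) = x μ := oneRelLift_gen x hrel'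
  refine ⟨AlgEquiv.ofBijective φ ⟨injective_of_exact hx1 hx hexact φ hφ,
    surjective_of_generates _ hx φ hφ⟩, hφ, fun n => ?_⟩
  apply le_antisymm
  · exact grading_map_le _ hx1 φ hφ n
  · intro a ha
    obtain ⟨c, rfl⟩ := surjective_of_generates _ hx φ hφ a
    refine ⟨DirectSum.decompose (grading (Submodule.span K {B})) c n, SetLike.coe_mem _, ?_⟩
    change φ _ = _
    rw [map_decompose _ hx1 φ hφ, DirectSum.decompose_of_mem_same 𝒜 ha]

end Isomorphism

/-! ### From bilinear forms to matrices -/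

theorem formRelations_eq_span_toMatrix' {K : Type u} [Field K] {s : ℕ}
    (b : LinearMap.BilinForm K (Fin (s + 1) → K)) :
    formRelations b = Submodule.span K {LinearMap.BilinForm.toMatrix' b} := by
  rw [formRelations]
  congr 2

theorem theorem3 {K : Type u} [Field K] (s : ℕ) (hs : 1 ≤ s) :
    (∀ b : LinearMap.BilinForm K (Fin (s + 1) → K), b.Nondegenerate →
      QuadraticAlg.IsKoszul (formRelations b) ∧
      globalDimension (QuadraticAlg (formRelations b)) = 2 ∧
      IsGorenstein (QuadraticAlg.grading (formRelations b)) 2) ∧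
    (∀ (A : Type u) [Ring A] [Algebra K A] (𝒜 : ℕ → Submodule K A) [GradedAlgebra 𝒜]
      [IsConnectedGraded 𝒜] (x : Fin (s + 1) → A),
      IsGeneratedInDegreeOne 𝒜 x → globalDimension A = 2 → IsGorenstein 𝒜 2 →
      ∃ b : LinearMap.BilinForm K (Fin (s + 1) → K), b.Nondegenerate ∧
        ∃ e : QuadraticAlg (formRelations b) ≃ₐ[K] A,
          (∀ μ, e (QuadraticAlg.gen (formRelations b) μ) = x μ) ∧
          ∀ n, (QuadraticAlg.grading (formRelations b) n).map e.toLinearMap = 𝒜 n) := by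
  have : Nontrivial (Fin (s + 1)) := Fin.nontrivial_iff_two_le.2 (by omega)
  refine ⟨fun b hb => ?_, fun A _ _ 𝒜 _ _ x hx hdim hgor => ?_⟩
  · have hB : (LinearMap.BilinForm.toMatrix' b).det ≠ 0 :=
      (LinearMap.BilinForm.nondegenerate_toMatrix'_iff.2 hb).det_ne_zero
    rw [formRelations_eq_span_toMatrix' b]
    exact ⟨QuadraticAlg.isKoszul_oneRel hB, QuadraticAlg.globalDimension_oneRel hB,
      QuadraticAlg.isGorenstein_oneRel hB⟩
  · have : HasProjectiveDimensionLE (trivialModule 𝒜) 2 :=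
      (projectiveDimension_le_iff _ 2).1
        ((le_iSup (fun M : ModuleCat.{u} A => projectiveDimension M) _).trans hdim.le)
    obtain ⟨-, e, he⟩ := hgor
    obtain ⟨B, hB, hrel, hexact⟩ := exists_matrix_syzygies hx e he
    refine ⟨Matrix.toBilin' B,
      LinearMap.BilinForm.nondegenerate_toBilin'_iff_det_ne_zero.2 hB, ?_⟩
    rw [formRelations_eq_span_toMatrix', LinearMap.BilinForm.toMatrix'_toBilin']
    exact QuadraticAlg.exists_algEquiv_oneRel hx.degree_one hx.generates hrel hexact
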